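/- Let $\eta=\frac{1+\sqrt{-7}}{2}$, so that $\mathbb Z[\eta]$ is the ring of integers of $\mathbb Q(\sqrt{-7})$ (class number $1$, units $\pm1$), and let $\chi$ be the Hecke character given on ideals by $$\chi\big((a+b\eta)\big)=\epsilon_{a,b}\,(a+b\eta),\qquad \epsilon_{a,b}=\left(\frac{a^3-2a^2b-ab^2+b^3}{7}\right)\quad(a,b\in\mathbb Z),$$ where $\left(\frac{\cdot}{7}\right)$ is the Legendre symbol (so $\epsilon_{a,b}\equiv(a+b\eta)^3 \bmod \sqrt{-7}$, and $\chi$ vanishes at ideals not prime to $\sqrt{-7}$). For an integer $k\ge 1$ and $\operatorname{Re}s>1$ put $$L(s,\chi^{k})=\frac12\sum_{(a,b)\ne(0,0)}\frac{\chi((a+b\eta))^{k}}{(a^2+ab+2b^2)^{s+k/2}}.$$ For every integer $n\ge1$ the function $L(s,\chi^{4n-3})$ continues to an entire function of $s$ (the central point is $s=1/2$), and there are a constant $c>0$ and an integer $N_0$ such that for every integer $N\ge N_0$ $$\#\{1\le n\le N:\ L(1/2,\chi^{4n-3})\ne 0\}\ \ge\ c\,\frac{N}{(\log N)^2}.$$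 -/

import Mathlib

open Filter

noncomputable section

namespace HeckeSeven

instance fact_prime_seven : Fact (Nat.Prime 7) := ⟨by norm_num⟩

/-- `η = (1 + √-7) / 2`; the integers of `ℚ(√-7)` are the numbers `a + b η` with `a b : ℤ`. -/
def eta : ℂ := (1 + (Real.sqrt 7 : ℂ) * Complex.I) / 2

/-- The norm `a² + a b + 2 b²` of `a + b η`. -/
def normForm (a b : ℤ) : ℤ := a ^ 2 + a * b + 2 * b ^ 2

/-- The sign `ε_{a,b} ≡ (a + b η)³ mod √-7`, as the Legendre symbol modulo `7` of
`a³ - 2a²b - ab² + b³`; it is `0` when `a + b η` is not prime to `√-7`. -/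
def epsilon (a b : ℤ) : ℤ := legendreSym 7 (a ^ 3 - 2 * a ^ 2 * b - a * b ^ 2 + b ^ 3)

/-- The value `χ((a + b η)) = ε_{a,b} (a + b η)` of the Hecke character at the ideal `(a + b η)`
(and `0` at ideals that are not prime to `√-7`). -/
def heckeChar (a b : ℤ) : ℂ := (epsilon a b : ℂ) * ((a : ℂ) + (b : ℂ) * eta)

/-- The two generators `± (a + b η)` of an ideal give the same value. -/
theorem heckeChar_neg (a b : ℤ) : heckeChar (-a) (-b) = heckeChar a b := by
  have h1 : legendreSym 7 (-1) = -1 := by decide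
  have h2 : epsilon (-a) (-b) = - epsilon a b := by
    unfold epsilon
    have : (-a) ^ 3 - 2 * (-a) ^ 2 * (-b) - (-a) * (-b) ^ 2 + (-b) ^ 3
        = (-1) * (a ^ 3 - 2 * a ^ 2 * b - a * b ^ 2 + b ^ 3) := by ring
    rw [this, legendreSym.mul, h1]
    ring
  unfold heckeChar
  rw [h2]
  push_cast
  ring

/-- The term at `(a, b)` of the series
`L(s, χᵏ) = (1/2) ∑_{(a,b) ≠ (0,0)} χ((a + b η))ᵏ / (a² + a b + 2 b²)^(s + k/2)`,
in the normalisation in which the central point is `s = 1/2`. The factor `1/2` accounts for the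
two generators of each ideal. -/
def heckeTerm (k : ℕ) (s : ℂ) (p : ℤ × ℤ) : ℂ :=
  if p = 0 then 0
  else (1 / 2) * (heckeChar p.1 p.2 ^ k / (normForm p.1 p.2 : ℂ) ^ (s + (k : ℂ) / 2))

/-- `F` is the entire function `L(s, χᵏ)`: it is holomorphic on `ℂ`, and for `Re s > 1` it is the
sum of the (absolutely convergent) Hecke series. -/
def IsHeckeLFunction (k : ℕ) (F : ℂ → ℂ) : Prop :=
  Differentiable ℂ F ∧ ∀ s : ℂ, 1 < s.re → HasSum (heckeTerm k s) (F s)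

/-- There is at most one such function. -/
theorem IsHeckeLFunction.unique {k : ℕ} {F G : ℂ → ℂ} (hF : IsHeckeLFunction k F)
    (hG : IsHeckeLFunction k G) : F = G := by
  have hU : IsOpen {s : ℂ | 1 < s.re} := isOpen_lt continuous_const Complex.continuous_re
  have h2 : (2 : ℂ) ∈ {s : ℂ | 1 < s.re} := by simp
  refine AnalyticOnNhd.eq_of_eventuallyEq (z₀ := 2)
    (fun z _ => hF.1.analyticAt z) (fun z _ => hG.1.analyticAt z) ?_
  filter_upwards [hU.mem_nhds h2] with s hs
  exact (hF.2 s hs).unique (hG.2 s hs)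

open Classical in
/-- The Hecke `L`-function `L(s, χᵏ)`, defined on all of `ℂ` by analytic continuation. -/
def heckeL (k : ℕ) : ℂ → ℂ :=
  if h : ∃ F : ℂ → ℂ, IsHeckeLFunction k F then h.choose else 0

/-- Any entire continuation of the series is `heckeL`. -/
theorem IsHeckeLFunction.eq_heckeL {k : ℕ} {F : ℂ → ℂ} (hF : IsHeckeLFunction k F) :
    F = heckeL k := by
  have h : ∃ F : ℂ → ℂ, IsHeckeLFunction k F := ⟨F, hF⟩
  unfold heckeL
  rw [dif_pos h]
  exact hF.unique h.choose_spec

end HeckeSeven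

end

noncomputable section

namespace HeckeSeven

/-! ### Lattice points: norm, sign and Gaussian summability. -/

section

/-! The central values are detected by their first two moments over a dyadic block `N ≤ j < 2N` of
the exponents `k = 4j + 1`.

Continuation. The theta series of `ε(α) αᵏ` with weight `exp(-2πtN(α)/7)` satisfies `θ(1/t) =
t^(k+1) θ(t)` when `k ≡ 1 mod 4` (`theta_functional_equation`). This is proved for all `k` at once
through the generating function in `exp(wα)`: in the coordinates `u = 2a + b`, `v = b` the norm is
`(u² + 7v²)/4` and the sign is `(u/7)`, so it splits over the common parity of `u` and `v` into
products of one-variable theta series, to which Poisson summation applies. The Mellin transform of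
`θ` gives the entire function (`isHeckeLFunction_heckeEntire`), with root number `+1`.

Central values. Splitting the Mellin integral at `t = 1` gives (`hasSum_centerTerm`) `L(1/2,
χ^(4j+1)) = ∑ ε(α) α/|α|² · z_α^j · Q(2πN(α)/7)`, where `z_α = (α/|α|)⁴` and `Q` is the probability
that a Poisson variable of that mean is at most `2j`. Truncating at `N(α) ≤ 20N` costs `O(exp(-N))`.
All positive integer multiples of a primitive `α` have the same phase, so each ray contributes
`z_α^j` times a real amplitude, which is bounded and of bounded variation in `j` (`abs_rayAmp_le`,
`sum_abs_rayAmp_sub_le`).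

Moments. For primitive `p`, `q` prime to `√-7`, `1 - z_p conj z_q` is governed by the trace and the
imaginary part of `p conj q`, two integers up to constants, of which the first never vanishes and
the second vanishes only for `q = ±p` (`rayPhase_sep`). Partial summation and a count of lattice
points on lines bound the off-diagonal terms. In the first moment the rays of `±1` give at least
`N/4` and the others `O(√N log N)` (`first_moment_ge`); the second moment is `O(N log² N)`
(`second_moment_le`). Cauchy–Schwarz then yields `≫ N / log² N` nonzero values
(`exists_card_ne_zero_ge`). -/

def latPt (p : ℤ × ℤ) : ℂ := (p.1 : ℂ) + (p.2 : ℂ) * eta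
-- The cubic is congruent to `(2a + b)³` modulo 7, and a quadratic symbol does not change under
-- cubing. The sign thus depends on a single linear coordinate, which is what lets the theta series
-- factor.
theorem epsilon_eq (a b : ℤ) : epsilon a b = legendreSym 7 (2 * a + b) := by
  have h : legendreSym 7 (a ^ 3 - 2 * a ^ 2 * b - a * b ^ 2 + b ^ 3)
      = legendreSym 7 ((2 * a + b) ^ 3) := by
    rw [legendreSym.mod 7 (a ^ 3 - 2 * a ^ 2 * b - a * b ^ 2 + b ^ 3),
      legendreSym.mod 7 ((2 * a + b) ^ 3)]
    congr 1
    refine (Int.modEq_iff_dvd.mpr ⟨a ^ 3 + 2 * a ^ 2 * b + a * b ^ 2, ?_⟩)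
    ring
  have h3 : ∀ u : ℤ, legendreSym 7 (u ^ 3) = legendreSym 7 u := by
    intro u
    rw [pow_succ, pow_two, legendreSym.mul, legendreSym.mul]
    rcases quadraticChar_isQuadratic (ZMod 7) (u : ZMod 7) with h | h | h <;>
      simp only [legendreSym, h] <;> norm_num
  rw [epsilon, h, h3]

theorem norm_latPt_sq (p : ℤ × ℤ) : ‖latPt p‖ ^ 2 = (normForm p.1 p.2 : ℝ) := by
  have h7 : Real.sqrt 7 * Real.sqrt 7 = 7 := Real.mul_self_sqrt (by norm_num)
  rw [← Complex.normSq_eq_norm_sq, Complex.normSq_apply]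
  simp [latPt, eta, normForm]
  linear_combination (p.2 : ℝ) ^ 2 / 4 * h7

theorem half_sq_le_normForm (a b : ℤ) : ((a : ℝ) ^ 2 + (b : ℝ) ^ 2) / 2 ≤ (normForm a b : ℝ) := by
  simp only [normForm]; push_cast
  nlinarith [sq_nonneg ((a : ℝ) + b), sq_nonneg (b : ℝ)]

theorem normForm_nonneg (a b : ℤ) : 0 ≤ normForm a b := by
  simp only [normForm]
  nlinarith [sq_nonneg (a + b), sq_nonneg b, sq_nonneg a]

theorem one_le_normForm {p : ℤ × ℤ} (hp : p ≠ 0) : 1 ≤ normForm p.1 p.2 := by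
  by_contra h
  have h0 : normForm p.1 p.2 = 0 := le_antisymm (by omega) (normForm_nonneg _ _)
  have h1 := half_sq_le_normForm p.1 p.2
  rw [h0] at h1
  have ha : (p.1 : ℝ) = 0 := by push_cast at h1; nlinarith [sq_nonneg (p.1 : ℝ), sq_nonneg (p.2 : ℝ)]
  have hb : (p.2 : ℝ) = 0 := by push_cast at h1; nlinarith [sq_nonneg (p.1 : ℝ), sq_nonneg (p.2 : ℝ)]
  exact hp (Prod.ext (by exact_mod_cast ha) (by exact_mod_cast hb))

theorem summable_exp_neg_abs_int {c : ℝ} (hc : 0 < c) :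
    Summable fun a : ℤ => Real.exp (-c * |(a : ℝ)|) := by
  have h : Summable fun n : ℕ => Real.exp (-c * (n : ℝ)) := by
    have := Real.summable_exp_nat_mul_iff.mpr (neg_lt_zero.mpr hc)
    simpa [mul_comm] using this
  exact Summable.of_nat_of_neg (by simpa using h) (by simpa using h)

theorem summable_exp_neg_normForm {c : ℝ} (hc : 0 < c) :
    Summable fun p : ℤ × ℤ => Real.exp (-c * (normForm p.1 p.2 : ℝ)) := by
  have h := (summable_exp_neg_abs_int (c := c / 2) (by positivity))
  have h2 := h.mul_of_nonneg h (fun _ => (Real.exp_pos _).le) (fun _ => (Real.exp_pos _).le)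
  refine Summable.of_nonneg_of_le (fun _ => (Real.exp_pos _).le) (fun p => ?_) h2
  rw [← Real.exp_add]
  refine Real.exp_le_exp.mpr ?_
  have key : ∀ a : ℤ, |(a : ℝ)| ≤ (a : ℝ) ^ 2 := by
    intro a
    rw [← sq_abs]
    have : (0 : ℤ) = |a| ∨ 1 ≤ |a| := by have := abs_nonneg a; omega
    rcases this with h | h
    · have : (0 : ℝ) = |(a : ℝ)| := by exact_mod_cast h
      rw [← this]; norm_num
    · have : (1 : ℝ) ≤ |(a : ℝ)| := by exact_mod_cast h
      nlinarith
  have := half_sq_le_normForm p.1 p.2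
  nlinarith [key p.1, key p.2]

/-- Completing the square spends half of the Gaussian decay on absorbing the exponential. -/
theorem summable_exp_norm_latPt (R : ℝ) {c : ℝ} (hc : 0 < c) :
    Summable fun p : ℤ × ℤ => Real.exp (R * ‖latPt p‖) * Real.exp (-c * (normForm p.1 p.2 : ℝ)) := by
  refine Summable.of_nonneg_of_le (fun _ => by positivity) (fun p => ?_)
    ((summable_exp_neg_normForm (c := c / 2) (by positivity)).mul_left (Real.exp (R ^ 2 / (2 * c))))
  rw [← Real.exp_add, ← Real.exp_add]
  refine Real.exp_le_exp.mpr ?_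
  rw [← norm_latPt_sq]
  have : R ^ 2 / (2 * c) + -(c / 2) * ‖latPt p‖ ^ 2 - (R * ‖latPt p‖ + -c * ‖latPt p‖ ^ 2)
      = (c * ‖latPt p‖ - R) ^ 2 / (2 * c) := by field_simp; ring
  have h2 : 0 ≤ (c * ‖latPt p‖ - R) ^ 2 / (2 * c) := by positivity
  linarith

theorem summable_pow_norm_latPt (k : ℕ) {c : ℝ} (hc : 0 < c) :
    Summable fun p : ℤ × ℤ => ‖latPt p‖ ^ k * Real.exp (-c * (normForm p.1 p.2 : ℝ)) := by
  refine Summable.of_nonneg_of_le (fun _ => by positivity) (fun p => ?_)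
    ((summable_exp_norm_latPt 1 hc).mul_left (k.factorial : ℝ))
  rw [← mul_assoc]
  gcongr
  have := Real.pow_div_factorial_le_exp (‖latPt p‖) (norm_nonneg _) k
  rw [div_le_iff₀ (by positivity)] at this
  rw [one_mul]; linarith

end

/-! ### Poisson summation for Gaussians on arithmetic progressions. -/

section

open Complex

theorem summable_gaussian (v : ℂ) {T : ℝ} (hT : 0 < T) :
    Summable fun n : ℤ => cexp (v * n - Real.pi * T * n ^ 2) := by
  have h := (summable_jacobiTheta₂_term_iff (v / (2 * Real.pi * I)) (I * T)).mpr (by simpa using hT)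
  refine h.congr fun n => ?_
  rw [jacobiTheta₂_term]
  congr 1
  have hpi : (Real.pi : ℂ) ≠ 0 := by exact_mod_cast Real.pi_ne_zero
  field_simp
  linear_combination (Real.pi * (n : ℂ) ^ 2 * T) * I_sq

/-- Poisson summation, read off from the functional equation of the Jacobi theta function at `τ =
iT`. -/
theorem tsum_gaussian (v : ℂ) {T : ℝ} (hT : 0 < T) :
    ∑' n : ℤ, cexp (v * n - Real.pi * T * n ^ 2)
      = (1 / (Real.sqrt T : ℂ)) * ∑' d : ℤ, cexp ((v - 2 * Real.pi * I * d) ^ 2 / (4 * Real.pi * T)) := by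
  have hpi : (Real.pi : ℂ) ≠ 0 := by exact_mod_cast Real.pi_ne_zero
  have hT' : (T : ℂ) ≠ 0 := by exact_mod_cast hT.ne'
  have h := jacobiTheta₂_functional_equation (v / (2 * Real.pi * I)) (I * T)
  have h1 : jacobiTheta₂ (v / (2 * Real.pi * I)) (I * T)
      = ∑' n : ℤ, cexp (v * n - Real.pi * T * n ^ 2) := by
    refine tsum_congr fun n => ?_
    rw [jacobiTheta₂_term]
    congr 1
    field_simp
    linear_combination (Real.pi * (n : ℂ) ^ 2 * T) * I_sq
  have h2 : (-I * (I * T)) ^ (1 / 2 : ℂ) = (Real.sqrt T : ℂ) := by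
    rw [show -I * (I * (T : ℂ)) = T by linear_combination (-(T : ℂ)) * I_sq, Real.sqrt_eq_rpow,
      ofReal_cpow hT.le]
    norm_num
  rw [← h1, h, h2, mul_assoc]
  congr 1
  rw [jacobiTheta₂, ← tsum_mul_left]
  refine tsum_congr fun n => ?_
  rw [jacobiTheta₂_term, ← Complex.exp_add]
  congr 1
  have hI : I ^ 4 = 1 := I_pow_four
  field_simp
  ring_nf
  simp only [I_sq, I_pow_three, I_pow_four]
  ring

/-- Substituting `n = Mj + r` turns the sum into a full Gaussian with parameter `M²T`; the shift by
`r` reappears on the dual side as the phase `e(rd/M)`. -/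
theorem tsum_gaussian_progression (v : ℂ) {T : ℝ} (hT : 0 < T) {M : ℕ} (hM : 0 < M) (r : ℤ) :
    ∑' j : ℤ, cexp (v * ((M : ℤ) * j + r : ℤ) - Real.pi * T * ((M : ℤ) * j + r : ℤ) ^ 2)
      = (1 / ((M : ℂ) * (Real.sqrt T : ℂ))) * ∑' d : ℤ, cexp (2 * Real.pi * I * r * d / M) *
        cexp ((v - 2 * Real.pi * I * d / M) ^ 2 / (4 * Real.pi * T)) := by
  have hpi : (Real.pi : ℂ) ≠ 0 := by exact_mod_cast Real.pi_ne_zero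
  have hT' : (T : ℂ) ≠ 0 := by exact_mod_cast hT.ne'
  have hMR : (0 : ℝ) < M := by exact_mod_cast hM
  have hM' : (M : ℂ) ≠ 0 := by exact_mod_cast hM.ne'
  have h := tsum_gaussian (M * v - 2 * Real.pi * T * M * r) (T := (M : ℝ) ^ 2 * T) (by positivity)
  have h1 : ∀ j : ℤ, cexp (v * ((M : ℤ) * j + r : ℤ) - Real.pi * T * ((M : ℤ) * j + r : ℤ) ^ 2)
      = cexp (v * r - Real.pi * T * r ^ 2) *
        cexp ((M * v - 2 * Real.pi * T * M * r) * j - Real.pi * ((M : ℝ) ^ 2 * T : ℝ) * j ^ 2) := by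
    intro j
    rw [← Complex.exp_add]
    congr 1
    push_cast
    ring
  rw [tsum_congr h1, tsum_mul_left, h, Real.sqrt_mul (by positivity), Real.sqrt_sq hMR.le]
  rw [← mul_assoc, mul_comm (cexp _), mul_assoc, ← tsum_mul_left]
  push_cast
  congr 1
  refine tsum_congr fun d => ?_
  rw [← Complex.exp_add, ← Complex.exp_add]
  congr 1
  field_simp
  ring

end

/-! ### The quadratic Gauss sum modulo 7. -/

section

open Complex

theorem tsum_int_eq_sum_residues {f : ℤ → ℂ} (hf : Summable f) (M : ℕ) [NeZero M] :
    ∑' n, f n = ∑ r : Fin M, ∑' j : ℤ, f ((M : ℤ) * j + (r : ℕ)) := by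
  have h1 := (Int.divModEquiv M).symm.tsum_eq f
  have hs : Summable fun q : ℤ × Fin M => f ((Int.divModEquiv M).symm q) :=
    (Int.divModEquiv M).symm.summable_iff.mpr hf
  rw [← h1, ← (Equiv.prodComm (Fin M) ℤ).tsum_eq]
  have hs' := (Equiv.prodComm (Fin M) ℤ).summable_iff.mpr hs
  have h2 := hs'.tsum_prod
  simp only [Function.comp_def] at h2
  rw [h2, tsum_fintype]
  refine Finset.sum_congr rfl fun r _ => tsum_congr fun j => ?_
  simp [Int.divModEquiv, mul_comm]

theorem tsum_int_even_odd {f : ℤ → ℂ} (hf : Summable f) :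
    ∑' n, f n = ∑' j : ℤ, f (2 * j + 0) + ∑' j : ℤ, f (2 * j + 1) := by
  simpa using tsum_int_eq_sum_residues hf 2

/-- A primitive fourteenth root of unity. -/
def zeta : ℂ := cexp (Real.pi * I / 7)

theorem zeta_pow_seven : zeta ^ 7 = -1 := by
  rw [zeta, ← Complex.exp_nat_mul, ← Complex.exp_pi_mul_I]
  congr 1
  push_cast
  ring

theorem zeta_cyclotomic :
    zeta ^ 6 - zeta ^ 5 + zeta ^ 4 - zeta ^ 3 + zeta ^ 2 - zeta + 1 = 0 := by
  have h1 : zeta + 1 ≠ 0 := by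
    intro h
    have hz : zeta = -1 := by linear_combination h
    have h2 : zeta.im = Real.sin (Real.pi / 7) := by
      rw [zeta, show (Real.pi * I / 7 : ℂ) = ((Real.pi / 7 : ℝ) : ℂ) * I by push_cast; ring,
        Complex.exp_ofReal_mul_I_im]
    have h3 : 0 < Real.sin (Real.pi / 7) :=
      Real.sin_pos_of_pos_of_lt_pi (by positivity) (by linarith [Real.pi_pos])
    rw [← h2, hz] at h3
    simp at h3
  have h := zeta_pow_seven
  refine (mul_eq_zero.mp ?_).resolve_left h1
  linear_combination h

/-- The quadratic Gauss sum modulo seven. -/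
theorem gauss_sum_value :
    zeta ^ 2 + zeta ^ 4 - zeta ^ 6 + zeta ^ 8 - zeta ^ 10 - zeta ^ 12 = Real.sqrt 7 * I := by
  have h7 := zeta_pow_seven
  have hc := zeta_cyclotomic
  set g := zeta ^ 2 + zeta ^ 4 - zeta ^ 6 + zeta ^ 8 - zeta ^ 10 - zeta ^ 12 with hg
  have hr : ((Real.sqrt 7 : ℝ) : ℂ) ^ 2 = 7 := by
    rw [← ofReal_pow, Real.sq_sqrt (by norm_num)]; norm_num
  have hsq : (g - Real.sqrt 7 * I) * (g + Real.sqrt 7 * I) = 0 := by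
    have : g ^ 2 = -7 := by
      rw [hg]
      grind
    linear_combination this - 7 * I_sq - I ^ 2 * hr
  rcases mul_eq_zero.mp hsq with h | h
  · linear_combination h
  -- The square fixes the sum up to sign. The wrong sign would make its imaginary part negative,
  -- whereas it equals a sum of sines that is visibly positive.
  · exfalso
    have him : ∀ n : ℕ, (zeta ^ n).im = Real.sin (n * (Real.pi / 7)) := by
      intro n
      rw [zeta, ← Complex.exp_nat_mul,
        show ((n : ℂ) * (Real.pi * I / 7) : ℂ) = ((n * (Real.pi / 7) : ℝ) : ℂ) * I by
          push_cast; ring, Complex.exp_ofReal_mul_I_im]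
    have hg' : g = zeta ^ 2 + zeta ^ 4 - zeta ^ 6 - zeta ^ 1 + zeta ^ 3 + zeta ^ 5 := by
      clear him; rw [hg]; linear_combination (zeta - zeta ^ 3 - zeta ^ 5) * h7
    have hre : g = -(Real.sqrt 7 * I) := by linear_combination h
    have h1 : g.im = -Real.sqrt 7 := by rw [hre]; simp
    have h2 : g.im = 2 * (Real.sin (2 * (Real.pi / 7)) + Real.sin (4 * (Real.pi / 7))
        - Real.sin (6 * (Real.pi / 7))) := by
      have e (a b : ℝ) (hab : a + b = Real.pi) : Real.sin a = Real.sin b := by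
        rw [← Real.sin_pi_sub]; congr 1; linarith
      rw [hg']
      simp only [add_im, sub_im, him]
      push_cast
      rw [e (1 * (Real.pi / 7)) (6 * (Real.pi / 7)) (by ring),
        e (3 * (Real.pi / 7)) (4 * (Real.pi / 7)) (by ring),
        e (5 * (Real.pi / 7)) (2 * (Real.pi / 7)) (by ring)]
      ring
    have h3 : Real.sin (6 * (Real.pi / 7)) = Real.sin (Real.pi / 7) := by
      rw [← Real.sin_pi_sub]; congr 1; ring
    have h4 : 0 < Real.sin (4 * (Real.pi / 7)) :=
      Real.sin_pos_of_pos_of_lt_pi (by positivity) (by linarith [Real.pi_pos])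
    have h5 : Real.sin (Real.pi / 7) < Real.sin (2 * (Real.pi / 7)) :=
      Real.sin_lt_sin_of_lt_of_le_pi_div_two (by linarith [Real.pi_pos])
        (by linarith [Real.pi_pos]) (by linarith [Real.pi_pos])
    have h6 : 0 < Real.sqrt 7 := by positivity
    linarith

/-- The finite Fourier transform, modulo 14, of the Legendre symbol restricted to integers of parity
`p`: up to the parity sign it reproduces the symbol. A finite check once powers of `zeta` are
reduced modulo 14. -/
theorem sum_legendre_zeta_pow (p : ℕ) (hp : p < 2) (r : ℕ) (hr : r < 14) :
    ∑ h : Fin 7, (legendreSym 7 (2 * ((h : ℕ) : ℤ) + p) : ℂ) * zeta ^ ((2 * (h : ℕ) + p) * r)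
      = (-1) ^ (p * r) * (legendreSym 7 r : ℂ) * (Real.sqrt 7 * I) := by
  have h7 := zeta_pow_seven
  have hc := zeta_cyclotomic
  have v : legendreSym 7 0 = 0 ∧ legendreSym 7 1 = 1 ∧ legendreSym 7 2 = 1 ∧ legendreSym 7 3 = -1 ∧
    legendreSym 7 4 = 1 ∧ legendreSym 7 5 = -1 ∧ legendreSym 7 6 = -1 ∧ legendreSym 7 7 = 0 ∧
    legendreSym 7 8 = 1 ∧ legendreSym 7 9 = 1 ∧ legendreSym 7 10 = -1 ∧ legendreSym 7 11 = 1 ∧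
    legendreSym 7 12 = -1 ∧ legendreSym 7 13 = -1 := by decide
  obtain ⟨v0, v1, v2, v3, v4, v5, v6, v7, v8, v9, v10, v11, v12, v13⟩ := v
  rw [← gauss_sum_value]
  have hm : ∀ n : ℕ, zeta ^ n = zeta ^ (n % 14) := fun n =>
    pow_eq_pow_mod n (by rw [show 14 = 7 * 2 by norm_num, pow_mul, h7]; norm_num)
  simp only [Fin.sum_univ_seven]
  interval_cases p <;> interval_cases r <;>
    norm_num [v0, v1, v2, v3, v4, v5, v6, v7, v8, v9, v10, v11, v12, v13] <;>
    grind

end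

/-! ### One-variable theta series over a parity class. -/

section

open Complex

/-- The theta series over the residue class `q` modulo two. -/
def thetaY (q : ℤ) (T : ℝ) (v : ℂ) : ℂ :=
  ∑' j : ℤ, cexp (v * (2 * j + q : ℤ) - Real.pi * T * (2 * j + q : ℤ) ^ 2)

/-- The theta series over the residue class `q` modulo two, twisted by the Legendre symbol. -/
def thetaX (q : ℤ) (T : ℝ) (v : ℂ) : ℂ :=
  ∑' j : ℤ, (legendreSym 7 (2 * j + q) : ℂ) *
    cexp (v * (2 * j + q : ℤ) - Real.pi * T * (2 * j + q : ℤ) ^ 2)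

theorem norm_legendreSym_seven_le (m : ℤ) : ‖(legendreSym 7 m : ℂ)‖ ≤ 1 := by
  rcases quadraticChar_isQuadratic (ZMod 7) (m : ZMod 7) with h | h | h <;>
    simp [legendreSym, h]

theorem injective_two_mul_add (q : ℤ) : Function.Injective fun j : ℤ => 2 * j + q := by
  intro a b h; simp only at h; omega

theorem summable_thetaY (q : ℤ) {T : ℝ} (hT : 0 < T) (v : ℂ) :
    Summable fun j : ℤ => cexp (v * (2 * j + q : ℤ) - Real.pi * T * (2 * j + q : ℤ) ^ 2) :=
  (summable_gaussian v hT).comp_injective (injective_two_mul_add q)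

theorem summable_thetaX (q : ℤ) {T : ℝ} (hT : 0 < T) (v : ℂ) :
    Summable fun j : ℤ => (legendreSym 7 (2 * j + q) : ℂ) *
      cexp (v * (2 * j + q : ℤ) - Real.pi * T * (2 * j + q : ℤ) ^ 2) := by
  refine (summable_thetaY q hT v).norm.of_norm_bounded fun j => ?_
  rw [norm_mul]
  exact mul_le_of_le_one_left (norm_nonneg _) (norm_legendreSym_seven_le _)

theorem norm_exp_pi_mul_int (p : ℕ) (d : ℤ) : ‖cexp (Real.pi * I * p * d)‖ = 1 := by
  rw [show (Real.pi * I * p * d : ℂ) = ((Real.pi * p * d : ℝ) : ℂ) * I by push_cast; ring,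
    norm_exp_ofReal_mul_I]

theorem exp_pi_even (p : ℕ) (j : ℤ) : cexp (Real.pi * I * p * (2 * j + 0 : ℤ)) = 1 := by
  rw [← Complex.exp_int_mul_two_pi_mul_I (p * j)]
  congr 1; push_cast; ring

theorem exp_pi_odd (p : ℕ) (j : ℤ) : cexp (Real.pi * I * p * (2 * j + 1 : ℤ)) = (-1) ^ p := by
  rw [show (Real.pi * I * p * (2 * j + 1 : ℤ) : ℂ) = Real.pi * I * p * (2 * j + 0 : ℤ) + p * (Real.pi * I)
    by push_cast; ring, Complex.exp_add, exp_pi_even, Complex.exp_nat_mul, Complex.exp_pi_mul_I, one_mul]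

/-- Poisson summation on a progression modulo 2. The dual sum runs over all integers with the sign
`(-1)^(pd)`, hence over both parity classes. -/
theorem thetaY_functional_equation (p : ℕ) {T : ℝ} (hT : 0 < T) (v : ℂ) :
    thetaY p T v = 1 / (2 * (Real.sqrt T : ℂ)) * cexp (v ^ 2 / (4 * Real.pi * T)) *
      (thetaY 0 (1 / (4 * T)) (-I * v / (2 * T)) +
        (-1) ^ p * thetaY 1 (1 / (4 * T)) (-I * v / (2 * T))) := by
  have hpi : (Real.pi : ℂ) ≠ 0 := by exact_mod_cast Real.pi_ne_zero
  have hT' : (T : ℂ) ≠ 0 := by exact_mod_cast hT.ne'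
  have h := tsum_gaussian_progression v hT (M := 2) (by norm_num) p
  have hl : thetaY p T v = _ := h
  have hs := summable_gaussian (-I * v / (2 * T)) (T := 1 / (4 * T)) (by positivity)
  have hs' : Summable fun d : ℤ => cexp (Real.pi * I * p * d) *
      cexp ((-I * v / (2 * T)) * d - Real.pi * (1 / (4 * T) : ℝ) * d ^ 2) := by
    refine hs.norm.of_norm_bounded fun d => ?_
    rw [norm_mul, norm_exp_pi_mul_int, one_mul]
  have he : ∀ d : ℤ, cexp (2 * Real.pi * I * (p : ℤ) * d / (2 : ℕ)) *
      cexp ((v - 2 * Real.pi * I * d / (2 : ℕ)) ^ 2 / (4 * Real.pi * T))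
      = cexp (v ^ 2 / (4 * Real.pi * T)) * (cexp (Real.pi * I * p * d) *
      cexp ((-I * v / (2 * T)) * d - Real.pi * (1 / (4 * T) : ℝ) * d ^ 2)) := by
    intro d
    rw [← Complex.exp_add, ← Complex.exp_add, ← Complex.exp_add]
    congr 1
    push_cast
    field_simp
    ring_nf
    simp only [I_sq]
    ring
  rw [hl, tsum_congr he, tsum_mul_left, tsum_int_even_odd hs']
  simp only [exp_pi_even, exp_pi_odd, one_mul]
  rw [tsum_mul_left, ← mul_assoc]
  simp only [thetaY]
  push_cast
  rfl

theorem sum_legendre_exp (p : ℕ) (hp : p < 2) (d : ℤ) :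
    ∑ h : Fin 7, (legendreSym 7 (2 * ((h : ℕ) : ℤ) + p) : ℂ) *
        cexp (2 * Real.pi * I * (2 * ((h : ℕ) : ℤ) + p : ℤ) * d / (14 : ℕ))
      = cexp (Real.pi * I * p * d) * (legendreSym 7 d : ℂ) * (Real.sqrt 7 * I) := by
  obtain ⟨r, e, hr, hd⟩ : ∃ (r : ℕ) (e : ℤ), r < 14 ∧ d = 14 * e + r :=
    ⟨(d % 14).toNat, d / 14, by omega, by omega⟩
  have h1 : ∀ n : ℕ, cexp (2 * Real.pi * I * (n : ℤ) * d / (14 : ℕ)) = zeta ^ (n * r) := by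
    intro n
    rw [zeta, ← Complex.exp_nat_mul, ← mul_one (cexp ((n * r : ℕ) * _)),
      ← Complex.exp_int_mul_two_pi_mul_I (n * e), ← Complex.exp_add]
    congr 1
    rw [hd]; push_cast; ring
  have h2 : cexp (Real.pi * I * p * d) = (-1) ^ (p * r) := by
    rw [← Complex.exp_pi_mul_I, ← Complex.exp_nat_mul, ← mul_one (cexp ((p * r : ℕ) * _)),
      ← Complex.exp_int_mul_two_pi_mul_I (7 * p * e), ← Complex.exp_add]
    congr 1
    rw [hd]; push_cast; ring
  have h3 : legendreSym 7 d = legendreSym 7 r := by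
    rw [legendreSym.mod 7 d, legendreSym.mod 7 r]
    congr 1
    omega
  rw [h2, h3, ← sum_legendre_zeta_pow p hp r hr]
  refine Finset.sum_congr rfl fun h _ => ?_
  rw [← h1 (2 * (h : ℕ) + p)]
  push_cast
  rfl

/-- The symbol has period 7, so the parity class splits into seven progressions modulo 14. Their
dual phases add up to the Gauss sum, which returns the same symbol on the dual side. -/
theorem thetaX_functional_equation (p : ℕ) (hp : p < 2) {T : ℝ} (hT : 0 < T) (v : ℂ) :
    thetaX p T v = Real.sqrt 7 * I / (14 * (Real.sqrt T : ℂ)) * cexp (v ^ 2 / (4 * Real.pi * T)) *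
      (thetaX 0 (1 / (196 * T)) (-I * v / (14 * T)) +
        (-1) ^ p * thetaX 1 (1 / (196 * T)) (-I * v / (14 * T))) := by
  have hpi : (Real.pi : ℂ) ≠ 0 := by exact_mod_cast Real.pi_ne_zero
  have hT' : (T : ℂ) ≠ 0 := by exact_mod_cast hT.ne'
  have hs := summable_gaussian (-I * v / (14 * T)) (T := 1 / (196 * T)) (by positivity)
  set E : ℤ → ℂ := fun d => cexp ((v - 2 * Real.pi * I * d / (14 : ℕ)) ^ 2 / (4 * Real.pi * T)) with hE
  have hE' : ∀ d, E d = cexp (v ^ 2 / (4 * Real.pi * T)) *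
      cexp ((-I * v / (14 * T)) * d - Real.pi * (1 / (196 * T) : ℝ) * d ^ 2) := by
    intro d
    simp only [hE]
    rw [← Complex.exp_add]
    congr 1
    push_cast
    field_simp
    ring_nf
    simp only [I_sq]
    ring
  have hEs : Summable E := by
    simp_rw [funext hE']
    exact hs.mul_left _
  have hphase : ∀ (n d : ℤ), ‖cexp (2 * Real.pi * I * n * d / (14 : ℕ))‖ = 1 := by
    intro n d
    rw [show (2 * Real.pi * I * n * d / (14 : ℕ) : ℂ) = ((2 * Real.pi * n * d / 14 : ℝ) : ℂ) * I by
      push_cast; ring, norm_exp_ofReal_mul_I]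
  have h1 : thetaX p T v = ∑ h : Fin 7, (legendreSym 7 (2 * ((h : ℕ) : ℤ) + p) : ℂ) *
      (1 / (((14 : ℕ) : ℂ) * (Real.sqrt T : ℂ)) * ∑' d : ℤ,
        cexp (2 * Real.pi * I * (2 * ((h : ℕ) : ℤ) + p : ℤ) * d / (14 : ℕ)) * E d) := by
    rw [thetaX, tsum_int_eq_sum_residues (summable_thetaX p hT v) 7]
    refine Finset.sum_congr rfl fun h _ => ?_
    rw [← tsum_gaussian_progression v hT (M := 14) (by norm_num) (2 * ((h : ℕ) : ℤ) + p),
      ← tsum_mul_left]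
    refine tsum_congr fun j => ?_
    have e : (2 * ((7 : ℕ) * j + (h : ℕ)) + p : ℤ) = (14 : ℕ) * j + (2 * (h : ℕ) + p) := by
      push_cast; ring
    rw [e]
    congr 2
    rw [legendreSym.mod 7 ((14 : ℕ) * j + (2 * (h : ℕ) + p)),
      legendreSym.mod 7 (2 * (h : ℕ) + p)]
    congr 1
    push_cast
    omega
  have hterm : ∀ h : Fin 7, Summable fun d : ℤ => (legendreSym 7 (2 * ((h : ℕ) : ℤ) + p) : ℂ) *
      (cexp (2 * Real.pi * I * (2 * ((h : ℕ) : ℤ) + p : ℤ) * d / (14 : ℕ)) * E d) := by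
    intro h
    refine Summable.mul_left _ (hEs.norm.of_norm_bounded fun d => ?_)
    rw [norm_mul, hphase, one_mul]
  have hs' : Summable fun d : ℤ => cexp (Real.pi * I * p * d) * ((legendreSym 7 d : ℂ) *
      cexp ((-I * v / (14 * T)) * d - Real.pi * (1 / (196 * T) : ℝ) * d ^ 2)) := by
    refine hs.norm.of_norm_bounded fun d => ?_
    rw [norm_mul, norm_exp_pi_mul_int, one_mul, norm_mul]
    exact mul_le_of_le_one_left (norm_nonneg _) (norm_legendreSym_seven_le _)
  have h2 : thetaX p T v = 1 / (((14 : ℕ) : ℂ) * (Real.sqrt T : ℂ)) * (Real.sqrt 7 * I *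
      cexp (v ^ 2 / (4 * Real.pi * T)) * ∑' d : ℤ, cexp (Real.pi * I * p * d) *
      ((legendreSym 7 d : ℂ) *
      cexp ((-I * v / (14 * T)) * d - Real.pi * (1 / (196 * T) : ℝ) * d ^ 2))) := by
    rw [h1]
    simp_rw [mul_left_comm _ (1 / (((14 : ℕ) : ℂ) * (Real.sqrt T : ℂ)))]
    rw [← Finset.mul_sum]
    congr 1
    simp_rw [← tsum_mul_left]
    rw [← Summable.tsum_finsetSum (fun h _ => hterm h)]
    refine tsum_congr fun d => ?_
    simp_rw [← mul_assoc]
    rw [← Finset.sum_mul, sum_legendre_exp p hp, hE']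
    ring
  rw [h2, tsum_int_even_odd hs']
  simp only [exp_pi_even, exp_pi_odd, one_mul]
  rw [tsum_mul_left]
  simp only [thetaX]
  push_cast
  ring

end

/-! ### The two-variable theta series and its functional equation. -/

section

open Complex

theorem norm_epsilon_le (p : ℤ × ℤ) : ‖(epsilon p.1 p.2 : ℂ)‖ ≤ 1 := by
  rw [epsilon_eq]; exact norm_legendreSym_seven_le _

/-- The Gaussian weight `exp(-2π t N(α) / 7)`, times the sign of `α`. -/
def thetaCoeff (t : ℝ) (p : ℤ × ℤ) : ℂ :=
  (epsilon p.1 p.2 : ℂ) * (Real.exp (-(2 * Real.pi / 7 * t) * (normForm p.1 p.2 : ℝ)) : ℂ)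

theorem norm_thetaCoeff_le (t : ℝ) (p : ℤ × ℤ) :
    ‖thetaCoeff t p‖ ≤ Real.exp (-(2 * Real.pi / 7 * t) * (normForm p.1 p.2 : ℝ)) := by
  rw [thetaCoeff, norm_mul, norm_real, Real.norm_eq_abs, Real.abs_exp]
  exact mul_le_of_le_one_left (Real.exp_pos _).le (norm_epsilon_le p)

theorem summable_norm_thetaCoeff_mul_exp {t : ℝ} (ht : 0 < t) (R : ℝ) :
    Summable fun p : ℤ × ℤ => ‖thetaCoeff t p‖ * Real.exp (R * ‖latPt p‖) := by
  refine Summable.of_nonneg_of_le (fun _ => by positivity) (fun p => ?_)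
    (summable_exp_norm_latPt R (c := 2 * Real.pi / 7 * t) (by positivity))
  rw [mul_comm]
  gcongr
  exact norm_thetaCoeff_le t p

theorem summable_thetaCoeff_mul_exp {t : ℝ} (ht : 0 < t) (w : ℂ) :
    Summable fun p : ℤ × ℤ => thetaCoeff t p * cexp (w * latPt p) := by
  refine (summable_norm_thetaCoeff_mul_exp ht ‖w‖).of_norm_bounded fun p => ?_
  rw [norm_mul]
  gcongr
  rw [Complex.norm_exp]
  refine Real.exp_le_exp.mpr ((re_le_norm _).trans (norm_mul _ _).le)

/-- The generating function of the theta series of `ε(α) αᵏ`. -/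
def thetaGen (t : ℝ) (w : ℂ) : ℂ := ∑' p : ℤ × ℤ, thetaCoeff t p * cexp (w * latPt p)

theorem thetaCoeff_mul_exp_eq (t : ℝ) (w : ℂ) (q i j : ℤ) :
    thetaCoeff t (i - j, 2 * j + q) * cexp (w * latPt (i - j, 2 * j + q))
      = ((legendreSym 7 (2 * i + q) : ℂ) * cexp ((w / 2) * (2 * i + q : ℤ)
          - Real.pi * (t / 14 : ℝ) * (2 * i + q : ℤ) ^ 2)) *
        cexp ((w * (Real.sqrt 7 * I) / 2) * (2 * j + q : ℤ)
          - Real.pi * (t / 2 : ℝ) * (2 * j + q : ℤ) ^ 2) := by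
  rw [thetaCoeff, epsilon_eq, show 2 * (i - j) + (2 * j + q) = 2 * i + q by ring, mul_assoc,
    mul_assoc, ofReal_exp, ← Complex.exp_add, ← Complex.exp_add]
  congr 2
  simp only [latPt, eta, normForm]
  push_cast
  ring

/-- The lattice is the set of `(u, v)` with `u ≡ v mod 2`, where `u = 2a + b` and `v = b`. On each
parity class both the weight and the sign are products of a function of `u` and a function of `v`.
-/
theorem thetaGen_eq {t : ℝ} (ht : 0 < t) (w : ℂ) :
    thetaGen t w = thetaX 0 (t / 14) (w / 2) * thetaY 0 (t / 2) (w * (Real.sqrt 7 * I) / 2)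
      + thetaX 1 (t / 14) (w / 2) * thetaY 1 (t / 2) (w * (Real.sqrt 7 * I) / 2) := by
  have hs := summable_thetaCoeff_mul_exp ht w
  have hs' := (Equiv.prodComm ℤ ℤ).summable_iff.mpr hs
  have key : ∀ q : ℤ, ∑' j : ℤ, ∑' a : ℤ, thetaCoeff t (a, 2 * j + q) *
      cexp (w * latPt (a, 2 * j + q))
      = thetaX q (t / 14) (w / 2) * thetaY q (t / 2) (w * (Real.sqrt 7 * I) / 2) := by
    intro q
    rw [thetaY, ← tsum_mul_left]
    refine tsum_congr fun j => ?_
    rw [← (Equiv.subRight j).tsum_eq]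
    simp only [Equiv.subRight_apply, thetaCoeff_mul_exp_eq]
    rw [tsum_mul_right, thetaX]
  rw [thetaGen, ← (Equiv.prodComm ℤ ℤ).tsum_eq]
  have h1 := hs'.tsum_prod
  simp only [Function.comp_def, Equiv.prodComm_apply, Prod.swap_prod_mk] at h1
  simp only [Equiv.prodComm_apply]
  refine h1.trans ?_
  have h2 := hs'.prod
  simp only [Function.comp_def, Equiv.prodComm_apply, Prod.swap_prod_mk] at h2
  rw [tsum_int_even_odd h2, key 0, key 1]

theorem thetaGen_functional_equation {t : ℝ} (ht : 0 < t) (w : ℂ) :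
    thetaGen t w = I / t * thetaGen (1 / t) (-I * w / t) := by
  have ht' : (t : ℂ) ≠ 0 := by exact_mod_cast ht.ne'
  have hpi : (Real.pi : ℂ) ≠ 0 := by exact_mod_cast Real.pi_ne_zero
  have hr : ((Real.sqrt 7 : ℝ) : ℂ) ^ 2 = 7 := by
    rw [← ofReal_pow, Real.sq_sqrt (by norm_num)]; norm_num
  have hr0 : ((Real.sqrt 7 : ℝ) : ℂ) ≠ 0 := by
    intro h; rw [h] at hr; norm_num at hr
  have e0 := thetaX_functional_equation 0 (by norm_num) (T := t / 14) (by positivity) (w / 2)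
  have e1 := thetaX_functional_equation 1 (by norm_num) (T := t / 14) (by positivity) (w / 2)
  have f0 := thetaY_functional_equation 0 (T := t / 2) (by positivity) (w * (Real.sqrt 7 * I) / 2)
  have f1 := thetaY_functional_equation 1 (T := t / 2) (by positivity) (w * (Real.sqrt 7 * I) / 2)
  rw [show 1 / (196 * (t / 14)) = 1 / t / 14 by field_simp; norm_num,
    show -I * (w / 2) / (14 * ((t / 14 : ℝ) : ℂ)) = -I * w / t / 2 by push_cast; field_simp] at e0 e1
  rw [show 1 / (4 * (t / 2)) = 1 / t / 2 by field_simp; norm_num,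
    show -I * (w * (Real.sqrt 7 * I) / 2) / (2 * ((t / 2 : ℝ) : ℂ))
      = -I * w / t * (Real.sqrt 7 * I) / 2 by push_cast; field_simp] at f0 f1
  push_cast at e0 e1 f0 f1
  rw [thetaGen_eq ht, thetaGen_eq (by positivity), e0, e1, f0, f1]
  -- The Gaussian factors in `w` cancel because `α` is an isotropic linear form for the norm form;
  -- equivalently, the powers `αᵏ` are harmonic.
  have hexp : cexp ((w / 2) ^ 2 / (4 * Real.pi * (t / 14))) *
      cexp ((w * (Real.sqrt 7 * I) / 2) ^ 2 / (4 * Real.pi * (t / 2))) = 1 := by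
    rw [← Complex.exp_add, ← Complex.exp_zero]
    congr 1
    field_simp
    rw [hr, I_sq]
    ring
  have hsq : ((Real.sqrt (t / 14) : ℝ) : ℂ) * ((Real.sqrt (t / 2) : ℝ) : ℂ) * (2 * Real.sqrt 7) = t := by
    rw [← ofReal_mul, ← Real.sqrt_mul (by positivity), show t / 14 * (t / 2) = (t / 2) ^ 2 / 7 by ring,
      Real.sqrt_div (by positivity), Real.sqrt_sq (by positivity)]
    push_cast
    field_simp
  have h1 : ((Real.sqrt (t / 14) : ℝ) : ℂ) ≠ 0 := by
    exact_mod_cast (Real.sqrt_pos.mpr (by positivity)).ne'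
  have h2 : ((Real.sqrt (t / 2) : ℝ) : ℂ) ≠ 0 := by
    exact_mod_cast (Real.sqrt_pos.mpr (by positivity)).ne'
  have hfac : Real.sqrt 7 * I / (14 * ((Real.sqrt (t / 14) : ℝ) : ℂ)) *
      (1 / (2 * ((Real.sqrt (t / 2) : ℝ) : ℂ))) * 2 = I / t := by
    rw [← hsq]
    field_simp
    rw [hr]; norm_num
  generalize cexp ((w / 2) ^ 2 / (4 * Real.pi * (t / 14))) = E1 at *
  generalize cexp ((w * (Real.sqrt 7 * I) / 2) ^ 2 / (4 * Real.pi * (t / 2))) = E2 at *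
  generalize Real.sqrt 7 * I / (14 * ((Real.sqrt (t / 14) : ℝ) : ℂ)) = F1 at *
  generalize (1 / (2 * ((Real.sqrt (t / 2) : ℝ) : ℂ))) = F2 at *
  rw [← hfac]
  -- The parity signs recombine through `(X₀ + X₁)(Y₀ + Y₁) + (X₀ - X₁)(Y₀ - Y₁) = 2(X₀Y₀ + X₁Y₁)`.
  linear_combination (F1 * F2 * 2 * (thetaX 0 (1 / t / 14) (-I * w / t / 2) *
    thetaY 0 (1 / t / 2) (-I * w / t * (Real.sqrt 7 * I) / 2) +
    thetaX 1 (1 / t / 14) (-I * w / t / 2) *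
    thetaY 1 (1 / t / 2) (-I * w / t * (Real.sqrt 7 * I) / 2))) * hexp

/-- Expanding each exponential and exchanging the sums is legitimate by absolute convergence. The
Taylor coefficients in `w` are then the moments, which makes it possible to extract one exponent `k`
at a time from an identity in `w`. -/
theorem hasSum_exp_moments {ι : Type*} {c α : ι → ℂ}
    (h : ∀ R : ℝ, Summable fun i => ‖c i‖ * Real.exp (R * ‖α i‖)) (w : ℂ) :
    HasSum (fun k : ℕ => ((∑' i, c i * α i ^ k) / (k.factorial : ℂ)) * w ^ k)
      (∑' i, c i * cexp (w * α i)) := by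
  have h1 : ∀ i, HasSum (fun k : ℕ => c i * ((w * α i) ^ k / (k.factorial : ℂ)))
      (c i * cexp (w * α i)) := by
    intro i
    have := NormedSpace.expSeries_div_hasSum_exp (𝔸 := ℂ) (w * α i)
    rw [← Complex.exp_eq_exp_ℂ] at this
    exact this.mul_left _
  have h2 : Summable fun q : ι × ℕ => c q.1 * ((w * α q.1) ^ q.2 / (q.2.factorial : ℂ)) := by
    refine Summable.of_norm ?_
    rw [summable_prod_of_nonneg (fun _ => norm_nonneg _)]
    have h3 : ∀ i, HasSum (fun k : ℕ => ‖c i * ((w * α i) ^ k / (k.factorial : ℂ))‖)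
        (‖c i‖ * Real.exp (‖w‖ * ‖α i‖)) := by
      intro i
      have := NormedSpace.expSeries_div_hasSum_exp (𝔸 := ℝ) (‖w‖ * ‖α i‖)
      rw [← Real.exp_eq_exp_ℝ] at this
      refine (this.mul_left ‖c i‖).congr_fun ?_
      intro k
      simp
    refine ⟨fun i => (h3 i).summable, ?_⟩
    simp_rw [fun i => (h3 i).tsum_eq]
    exact h ‖w‖
  have h4 := h2.hasSum.prod_fiberwise h1
  rw [h4.tsum_eq]
  have h5 := (Equiv.prodComm ℕ ι).hasSum_iff.mpr h2.hasSum
  have h6 := h5.prod_fiberwise (fun k => ((Equiv.prodComm ℕ ι).summable_iff.mpr h2).prod_factor k |>.hasSum)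
  refine h6.congr_fun ?_
  intro k
  simp only [Function.comp_def, Equiv.prodComm_apply, Prod.swap_prod_mk]
  rw [mul_comm, ← mul_div_assoc, ← tsum_mul_left, ← tsum_div_const]
  refine tsum_congr fun i => ?_
  rw [mul_pow]; ring

theorem coeff_eq_of_hasSum {a b : ℕ → ℂ} {F : ℂ → ℂ} (ha : ∀ w, HasSum (fun k => a k * w ^ k) (F w))
    (hb : ∀ w, HasSum (fun k => b k * w ^ k) (F w)) : a = b := by
  have key : ∀ {a : ℕ → ℂ}, (∀ w, HasSum (fun k => a k * w ^ k) (F w)) →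
      HasFPowerSeriesAt F (FormalMultilinearSeries.ofScalars ℂ a) 0 := by
    intro a ha
    refine ⟨1, ?_, one_pos, ?_⟩
    · refine FormalMultilinearSeries.le_radius_of_tendsto (r := 1) _ (l := 0) ?_
      have := (ha 1).summable.tendsto_atTop_zero.norm
      simpa [FormalMultilinearSeries.ofScalars_norm] using this
    · intro y _
      simpa [FormalMultilinearSeries.ofScalars_apply_eq, mul_comm] using ha y
  exact FormalMultilinearSeries.ofScalars_series_injective ℂ ℂ
    ((key ha).eq_formalMultilinearSeries (key hb))

/-- The theta series of `ε(α) αᵏ`. -/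
def theta (k : ℕ) (t : ℝ) : ℂ := ∑' p : ℤ × ℤ, thetaCoeff t p * latPt p ^ k

theorem theta_functional_equation {k : ℕ} (hk : k % 4 = 1) {t : ℝ} (ht : 0 < t) :
    theta k (1 / t) = (t : ℂ) ^ (k + 1) * theta k t := by
  have ht' : (t : ℂ) ≠ 0 := by exact_mod_cast ht.ne'
  have ha := hasSum_exp_moments (fun R => summable_norm_thetaCoeff_mul_exp ht R)
  have hb := hasSum_exp_moments
    (fun R => summable_norm_thetaCoeff_mul_exp (t := 1 / t) (by positivity) R)
  have hb' : ∀ w : ℂ, HasSum (fun j : ℕ => (I / t * (-I / t) ^ j *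
      (theta j (1 / t) / (j.factorial : ℂ))) * w ^ j) (thetaGen t w) := by
    intro w
    rw [thetaGen_functional_equation ht]
    refine ((hb (-I * w / t)).mul_left (I / t)).congr_fun ?_
    intro j
    rw [theta, show -I * w / t = (-I / t) * w by ring, mul_pow]
    ring
  have h := congrFun (coeff_eq_of_hasSum ha hb') k
  have hf : (k.factorial : ℂ) ≠ 0 := by exact_mod_cast k.factorial_ne_zero
  -- The root number; this is the place where the congruence of `k` modulo 4 decides the sign.
  have hI : I * (-I) ^ k = 1 := by
    obtain ⟨m, rfl⟩ : ∃ m, k = 4 * m + 1 := ⟨k / 4, by omega⟩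
    rw [pow_succ, pow_mul, show (-I) ^ 4 = 1 by rw [neg_pow, I_pow_four]; norm_num, one_pow]
    simp
  have h' : theta k t = I / t * (-I / t) ^ k * theta k (1 / t) := by
    change theta k t / _ = _ at h
    field_simp at h ⊢
    exact h
  rw [h', div_pow]
  field_simp
  linear_combination (-theta k (1 / t) * t ^ (k + 1)) * hI

end

/-! ### Mellin transform and analytic continuation. -/

section

open Complex Set

theorem epsilon_zero : epsilon 0 0 = 0 := by rw [epsilon_eq]; decide

theorem thetaCoeff_zero (t : ℝ) : thetaCoeff t 0 = 0 := by
  simp [thetaCoeff, epsilon_zero]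

theorem norm_theta_term_le (k : ℕ) (t : ℝ) (p : ℤ × ℤ) :
    ‖thetaCoeff t p * latPt p ^ k‖ ≤
      ‖latPt p‖ ^ k * Real.exp (-(2 * Real.pi / 7 * t) * (normForm p.1 p.2 : ℝ)) := by
  rw [norm_mul, norm_pow, mul_comm]
  gcongr
  exact norm_thetaCoeff_le t p

theorem hasSum_theta (k : ℕ) {t : ℝ} (ht : 0 < t) :
    HasSum (fun p => thetaCoeff t p * latPt p ^ k) (theta k t) :=
  ((summable_pow_norm_latPt k (c := 2 * Real.pi / 7 * t) (by positivity)).of_norm_bounded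
    (norm_theta_term_le k t)).hasSum

theorem continuousOn_theta (k : ℕ) : ContinuousOn (theta k) (Ioi 0) := by
  intro t ht
  have ht : 0 < t := ht
  have h : ContinuousOn (theta k) (Ioi (t / 2)) := by
    refine continuousOn_tsum (fun p => ?_)
      (summable_pow_norm_latPt k (c := 2 * Real.pi / 7 * (t / 2)) (by positivity)) (fun p x hx => ?_)
    · unfold thetaCoeff
      fun_prop
    · refine (norm_theta_term_le k x p).trans ?_
      have hN : (0 : ℝ) ≤ (normForm p.1 p.2 : ℝ) := by exact_mod_cast normForm_nonneg _ _
      have hx : t / 2 ≤ x := (mem_Ioi.mp hx).le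
      gcongr
  exact (h.continuousAt (Ioi_mem_nhds (by linarith))).continuousWithinAt

/-- The origin has sign zero, so every surviving term has norm at least 1. Then `(t - 1)(N(α) - 1) ≥
0` separates the decay in `t` from the summability in `α`. -/
theorem exists_norm_theta_le (k : ℕ) :
    ∃ C : ℝ, ∀ t : ℝ, 1 ≤ t → ‖theta k t‖ ≤ C * Real.exp (-(2 * Real.pi / 7) * t) := by
  have hs := summable_pow_norm_latPt k (c := 2 * Real.pi / 7) (by positivity)
  refine ⟨(∑' p : ℤ × ℤ, ‖latPt p‖ ^ k * Real.exp (-(2 * Real.pi / 7) * (normForm p.1 p.2 : ℝ))) *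
    Real.exp (2 * Real.pi / 7), fun t ht => ?_⟩
  rw [mul_assoc, ← Real.exp_add, ← tsum_mul_right]
  refine tsum_of_norm_bounded (hs.mul_right _).hasSum fun p => ?_
  rcases eq_or_ne p 0 with rfl | hp
  · rw [thetaCoeff_zero, zero_mul, norm_zero]; positivity
  refine (norm_theta_term_le k t p).trans ?_
  rw [mul_assoc, ← Real.exp_add]
  gcongr
  have hN : (1 : ℝ) ≤ (normForm p.1 p.2 : ℝ) := by exact_mod_cast one_le_normForm hp
  have hc : 0 < 2 * Real.pi / 7 := by positivity
  nlinarith [mul_nonneg (mul_nonneg hc.le (sub_nonneg.mpr ht)) (sub_nonneg.mpr hN)]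

theorem theta_isBigO (k : ℕ) (r : ℝ) : theta k =O[atTop] fun x : ℝ => x ^ r := by
  obtain ⟨C, hC⟩ := exists_norm_theta_le k
  refine Asymptotics.IsBigO.trans ?_
    (isLittleO_exp_neg_mul_rpow_atTop (a := 2 * Real.pi / 7) (by positivity) r).isBigO
  refine Asymptotics.IsBigO.of_bound C ?_
  filter_upwards [eventually_ge_atTop 1] with t ht
  rw [Real.norm_eq_abs, Real.abs_exp]
  exact hC t ht

/-- The pair of theta series entering the functional equation. -/
def thetaPair (k : ℕ) (hk : k % 4 = 1) : WeakFEPair ℂ where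
  f := theta k
  g := theta k
  k := k + 1
  ε := 1
  f₀ := 0
  g₀ := 0
  hf_int := (continuousOn_theta k).locallyIntegrableOn measurableSet_Ioi
  hg_int := (continuousOn_theta k).locallyIntegrableOn measurableSet_Ioi
  hk := by positivity
  hε := one_ne_zero
  h_feq := fun t ht => by
    rw [theta_functional_equation hk ht, one_mul, smul_eq_mul]
    congr 1
    exact_mod_cast (Real.rpow_natCast t (k + 1)).symm
  hf_top := fun r => by simpa using theta_isBigO k r
  hg_top := fun r => by simpa using theta_isBigO k r

theorem isStrongFEPair_thetaPair (k : ℕ) (hk : k % 4 = 1) : IsStrongFEPair (thetaPair k hk) :=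
  ⟨rfl, rfl⟩

theorem mellinConvergent_theta {k : ℕ} (hk : k % 4 = 1) (s : ℂ) : MellinConvergent (theta k) s :=
  ((isStrongFEPair_thetaPair k hk).hasMellin s).1

theorem differentiable_mellin_theta {k : ℕ} (hk : k % 4 = 1) :
    Differentiable ℂ (mellin (theta k)) := by
  have h := (isStrongFEPair_thetaPair k hk).differentiable_Λ
  have e : (thetaPair k hk).Λ = mellin (theta k) :=
    funext fun s => ((isStrongFEPair_thetaPair k hk).hasMellin s).2.symm
  rwa [e] at h

/-- The form dominates half the square of the sup norm, so the Eisenstein series of exponent `2σ >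
2` is a majorant. -/
theorem summable_normForm_rpow {σ : ℝ} (hσ : 1 < σ) :
    Summable fun p : ℤ × ℤ => ((normForm p.1 p.2 : ℝ)) ^ (-σ) := by
  have h := (finTwoArrowEquiv ℤ).symm.summable_iff.mpr
    (EisensteinSeries.summable_one_div_norm_rpow (k := 2 * σ) (by linarith))
  refine Summable.of_nonneg_of_le (fun p => ?_) (fun p => ?_) (h.mul_left ((2 : ℝ) ^ σ))
  · exact Real.rpow_nonneg (by exact_mod_cast normForm_nonneg _ _) _
  rcases eq_or_ne p 0 with rfl | hp
  · simp only [Prod.fst_zero, Prod.snd_zero, normForm]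
    norm_num
    rw [Real.zero_rpow (by linarith)]
    positivity
  simp only [Function.comp_apply]
  set x : Fin 2 → ℤ := (finTwoArrowEquiv ℤ).symm p with hx
  have hx0 : x ≠ 0 := by
    intro h
    apply hp
    have : (finTwoArrowEquiv ℤ) x = p := by rw [hx]; simp
    rw [← this, h]; rfl
  have hxpos : 0 < ‖x‖ := norm_pos_iff.mpr hx0
  have hle : ‖x‖ ^ 2 / 2 ≤ (normForm p.1 p.2 : ℝ) := by
    refine le_trans ?_ (half_sq_le_normForm p.1 p.2)
    have h0 : x 0 = p.1 := rfl
    have h1 : x 1 = p.2 := rfl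
    have : ‖x‖ ≤ Real.sqrt ((p.1 : ℝ) ^ 2 + (p.2 : ℝ) ^ 2) := by
      refine (pi_norm_le_iff_of_nonneg (Real.sqrt_nonneg _)).mpr fun i => ?_
      fin_cases i
      · refine Real.le_sqrt_of_sq_le ?_
        simp [h0, Int.norm_eq_abs]; positivity
      · refine Real.le_sqrt_of_sq_le ?_
        simp [h1, Int.norm_eq_abs]; positivity
    have h2 := pow_le_pow_left₀ hxpos.le this 2
    rw [Real.sq_sqrt (by positivity)] at h2
    linarith
  calc ((normForm p.1 p.2 : ℝ)) ^ (-σ) ≤ (‖x‖ ^ 2 / 2) ^ (-σ) :=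
        Real.rpow_le_rpow_of_nonpos (by positivity) hle (by linarith)
    _ = 2 ^ σ * ‖x‖ ^ (-(2 * σ)) := by
        rw [Real.div_rpow (by positivity) (by norm_num), ← Real.rpow_natCast ‖x‖ 2,
          ← Real.rpow_mul hxpos.le, Real.rpow_neg (by norm_num : (0:ℝ) ≤ 2)]
        push_cast
        rw [div_inv_eq_mul, mul_comm]
        congr 2
        ring

theorem epsilon_pow {k : ℕ} (hk : k % 4 = 1) (p : ℤ × ℤ) :
    (epsilon p.1 p.2 : ℂ) ^ k = (epsilon p.1 p.2 : ℂ) := by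
  have ho : Odd k := Nat.odd_iff.mpr (by omega)
  rw [epsilon_eq]
  rcases quadraticChar_isQuadratic (ZMod 7) ((2 * p.1 + p.2 : ℤ) : ZMod 7) with h | h | h
  · simp only [legendreSym, h]; simp [ho.pos.ne']
  · simp only [legendreSym, h]; simp
  · simp only [legendreSym, h]; simp [ho.neg_one_pow]

theorem norm_latPt_pow (k : ℕ) (p : ℤ × ℤ) :
    ‖latPt p‖ ^ k = ((normForm p.1 p.2 : ℝ)) ^ ((k : ℝ) / 2) := by
  rw [← norm_latPt_sq, ← Real.rpow_natCast, ← Real.rpow_natCast, ← Real.rpow_mul (norm_nonneg _)]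
  congr 1
  push_cast
  ring

theorem re_add_natCast_half (s : ℂ) (k : ℕ) : (s + (k : ℂ) / 2).re = s.re + k / 2 := by
  rw [add_re, div_ofNat_re, natCast_re]

theorem hasSum_mellin_theta (k : ℕ) {s : ℂ} (hs : 1 < s.re) :
    HasSum (fun p : ℤ × ℤ => Gamma (s + k / 2) * ((epsilon p.1 p.2 : ℂ) * latPt p ^ k) /
      (((2 * Real.pi / 7 * (normForm p.1 p.2 : ℝ) : ℝ)) : ℂ) ^ (s + k / 2))
      (mellin (theta k) (s + k / 2)) := by
  have hre := re_add_natCast_half s k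
  have hk0 : (0 : ℝ) ≤ k / 2 := by positivity
  refine hasSum_mellin (fun p => ?_) (by rw [hre]; linarith) (fun t ht => ?_) ?_
  · rcases eq_or_ne p 0 with rfl | hp
    · left; simp [epsilon_zero]
    · right
      have : (1 : ℝ) ≤ (normForm p.1 p.2 : ℝ) := by exact_mod_cast one_le_normForm hp
      positivity
  · refine (hasSum_theta k ht).congr_fun fun p => ?_
    rw [thetaCoeff, show -(2 * Real.pi / 7 * (normForm p.1 p.2 : ℝ)) * t
      = -(2 * Real.pi / 7 * t) * (normForm p.1 p.2 : ℝ) by ring]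
    ring
  · rw [hre]
    refine Summable.of_nonneg_of_le (fun p => ?_) (fun p => ?_)
      ((summable_normForm_rpow hs).mul_left ((2 * Real.pi / 7) ^ (-(s.re + k / 2))))
    · have : (0 : ℝ) ≤ (normForm p.1 p.2 : ℝ) := by exact_mod_cast normForm_nonneg _ _
      positivity
    · rcases eq_or_ne p 0 with rfl | hp
      · have : (0 : ℝ) ≤ (normForm (0 : ℤ × ℤ).1 (0 : ℤ × ℤ).2 : ℝ) := by
          exact_mod_cast normForm_nonneg _ _
        simp only [Prod.fst_zero, Prod.snd_zero, epsilon_zero, Int.cast_zero, zero_mul, norm_zero,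
          zero_div] at this ⊢
        positivity
      have hN : (0 : ℝ) < (normForm p.1 p.2 : ℝ) := by
        have : (1 : ℝ) ≤ (normForm p.1 p.2 : ℝ) := by exact_mod_cast one_le_normForm hp
        linarith
      rw [norm_mul, norm_pow, norm_latPt_pow, Real.mul_rpow (by positivity) hN.le,
        Real.rpow_neg (by positivity), Real.rpow_neg hN.le, Real.rpow_add hN]
      have hle := norm_epsilon_le p
      have h1 : 0 < (normForm p.1 p.2 : ℝ) ^ ((k : ℝ) / 2) := by positivity
      have h2 : 0 < (normForm p.1 p.2 : ℝ) ^ (s.re) := by positivity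
      have h3 : 0 < (2 * Real.pi / 7) ^ (s.re + (k : ℝ) / 2) := by positivity
      rw [div_le_iff₀ (by positivity)]
      field_simp
      exact hle

/-- The completed `L`-function divided by its archimedean factor. -/
def heckeEntire (k : ℕ) (s : ℂ) : ℂ :=
  1 / 2 * ((2 * Real.pi / 7 : ℝ) : ℂ) ^ (s + k / 2) * (Gamma (s + k / 2))⁻¹ *
    mellin (theta k) (s + k / 2)

/-- Holomorphy holds because `1/Γ` and the Mellin transform are both entire. In the half-plane of
convergence, integrating term by term produces the series, and `ε^k = ε` since `k` is odd. -/
theorem isHeckeLFunction_heckeEntire {k : ℕ} (hk : k % 4 = 1) :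
    IsHeckeLFunction k (heckeEntire k) := by
  constructor
  · have ha : Differentiable ℂ fun s : ℂ => s + (k : ℂ) / 2 := by fun_prop
    have hc : (((2 * Real.pi / 7 : ℝ)) : ℂ) ≠ 0 := by
      exact_mod_cast (by positivity : (0 : ℝ) < 2 * Real.pi / 7).ne'
    have h1 : Differentiable ℂ fun s : ℂ => (((2 * Real.pi / 7 : ℝ)) : ℂ) ^ (s + (k : ℂ) / 2) :=
      ha.const_cpow (Or.inl hc)
    have h2 : Differentiable ℂ fun s : ℂ => (Gamma (s + (k : ℂ) / 2))⁻¹ :=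
      differentiable_one_div_Gamma.comp ha
    have h3 : Differentiable ℂ fun s : ℂ => mellin (theta k) (s + (k : ℂ) / 2) :=
      (differentiable_mellin_theta hk).comp ha
    exact ((h1.const_mul _).mul h2).mul h3
  · intro s hs
    have hG : Gamma (s + (k : ℂ) / 2) ≠ 0 := by
      refine Gamma_ne_zero_of_re_pos ?_
      rw [re_add_natCast_half]
      positivity
    have hc : (((2 * Real.pi / 7 : ℝ)) : ℂ) ≠ 0 := by
      exact_mod_cast (by positivity : (0 : ℝ) < 2 * Real.pi / 7).ne'
    refine ((hasSum_mellin_theta k hs).mul_left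
      (1 / 2 * ((2 * Real.pi / 7 : ℝ) : ℂ) ^ (s + k / 2) * (Gamma (s + k / 2))⁻¹)).congr_fun
      fun p => ?_
    rw [heckeTerm]
    rcases eq_or_ne p 0 with rfl | hp
    · simp [epsilon_zero]
    rw [if_neg hp, heckeChar, mul_pow, epsilon_pow hk]
    have hN : (0 : ℝ) ≤ (normForm p.1 p.2 : ℝ) := by exact_mod_cast normForm_nonneg _ _
    rw [ofReal_mul, mul_cpow_ofReal_nonneg (by positivity) hN]
    have h0 : (((2 * Real.pi / 7 : ℝ)) : ℂ) ^ (s + (k : ℂ) / 2) ≠ 0 := by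
      simp [cpow_eq_zero_iff]
    rw [latPt]
    push_cast
    push_cast at h0
    generalize Gamma (s + (k : ℂ) / 2) = G at *
    field_simp

theorem isHeckeLFunction_heckeL {k : ℕ} (hk : k % 4 = 1) : IsHeckeLFunction k (heckeL k) := by
  have h := isHeckeLFunction_heckeEntire hk
  rwa [h.eq_heckeL] at h

end

/-! ### Poisson tails and the series for the central value. -/

section

open Complex Set MeasureTheory

/-- The probability that a Poisson variable of mean `x` is less than `M`. -/
def poissonTail (M : ℕ) (x : ℝ) : ℝ := Real.exp (-x) * ∑ j ∈ Finset.range M, x ^ j / (j.factorial : ℝ)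

theorem poissonTail_succ (M : ℕ) (x : ℝ) :
    poissonTail (M + 1) x = poissonTail M x + Real.exp (-x) * (x ^ M / (M.factorial : ℝ)) := by
  rw [poissonTail, poissonTail, Finset.sum_range_succ, mul_add]

theorem poissonTail_nonneg (M : ℕ) {x : ℝ} (hx : 0 ≤ x) : 0 ≤ poissonTail M x := by
  unfold poissonTail; positivity

theorem poissonTail_mono {x : ℝ} (hx : 0 ≤ x) : Monotone fun M => poissonTail M x := by
  refine monotone_nat_of_le_succ fun M => ?_
  rw [poissonTail_succ]
  have : 0 ≤ Real.exp (-x) * (x ^ M / (M.factorial : ℝ)) := by positivity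
  linarith

theorem poissonTail_le_one (M : ℕ) {x : ℝ} (hx : 0 ≤ x) : poissonTail M x ≤ 1 := by
  have h := Real.sum_le_exp_of_nonneg hx M
  rw [poissonTail, Real.exp_neg]
  exact inv_mul_le_one_of_le₀ h (Real.exp_pos x).le

/-- For `j < M` one has `x^j ≤ 2^M (x/2)^j`, which leaves a partial sum of `exp(x/2)`. A crude
bound, but it suffices far beyond the transition at `x ≈ M`. -/
theorem poissonTail_le (M : ℕ) {x : ℝ} (hx : 0 ≤ x) :
    poissonTail M x ≤ 2 ^ M * Real.exp (-(x / 2)) := by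
  have h : ∑ j ∈ Finset.range M, x ^ j / (j.factorial : ℝ) ≤ 2 ^ M * Real.exp (x / 2) := by
    refine le_trans ?_ (mul_le_mul_of_nonneg_left
      (Real.sum_le_exp_of_nonneg (show 0 ≤ x / 2 by positivity) M) (by positivity))
    rw [Finset.mul_sum]
    refine Finset.sum_le_sum fun j hj => ?_
    rw [div_pow, ← mul_div_assoc]
    have h2 : (2 : ℝ) ^ j ≤ 2 ^ M :=
      pow_le_pow_right₀ (by norm_num) (Finset.mem_range.mp hj).le
    gcongr
    rw [← mul_div_assoc, le_div_iff₀ (by positivity), mul_comm]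
    gcongr
  calc poissonTail M x ≤ Real.exp (-x) * (2 ^ M * Real.exp (x / 2)) := by
        unfold poissonTail; gcongr
    _ = 2 ^ M * (Real.exp (-x) * Real.exp (x / 2)) := by ring
    _ = _ := by rw [← Real.exp_add]; congr 2; ring

/-- Markov's inequality for a Poisson variable of mean `x`. -/
theorem one_sub_poissonTail_le (m : ℕ) {x : ℝ} (hx : 0 ≤ x) :
    1 - poissonTail (m + 1) x ≤ x / (m + 1) := by
  have hs : HasSum (fun j : ℕ => x ^ j / (j.factorial : ℝ)) (Real.exp x) := by
    rw [Real.exp_eq_exp_ℝ]; exact NormedSpace.expSeries_div_hasSum_exp x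
  have h1 := hs.summable.sum_add_tsum_nat_add (m + 1)
  have h2 := hs.summable.sum_add_tsum_nat_add m
  rw [hs.tsum_eq] at h1 h2
  have h3 : (m + 1 : ℝ) * ∑' i : ℕ, x ^ (i + (m + 1)) / ((i + (m + 1)).factorial : ℝ)
      ≤ x * ∑' i : ℕ, x ^ (i + m) / ((i + m).factorial : ℝ) := by
    rw [← tsum_mul_left, ← tsum_mul_left]
    refine Summable.tsum_le_tsum (fun i => ?_)
      (((summable_nat_add_iff (m + 1)).mpr hs.summable).mul_left _)
      (((summable_nat_add_iff m).mpr hs.summable).mul_left _)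
    rw [← add_assoc, Nat.factorial_succ, pow_succ, ← mul_div_assoc, ← mul_div_assoc]
    have hi : (0 : ℝ) ≤ i := by positivity
    have hm : (0 : ℝ) ≤ m := by positivity
    rw [div_le_div_iff₀ (by positivity) (by positivity)]
    push_cast
    have : 0 ≤ x ^ (i + m) * x * ((i + m).factorial : ℝ) := by positivity
    nlinarith
  have h4 : 0 ≤ ∑ i ∈ Finset.range m, x ^ i / (i.factorial : ℝ) := by positivity
  have h5 : Real.exp (-x) * Real.exp x = 1 := by rw [← Real.exp_add]; simp
  have h6 : 1 - poissonTail (m + 1) x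
      = Real.exp (-x) * ∑' i : ℕ, x ^ (i + (m + 1)) / ((i + (m + 1)).factorial : ℝ) := by
    rw [poissonTail]
    linear_combination -Real.exp (-x) * h1 - h5
  rw [h6, le_div_iff₀ (by positivity)]
  calc _ = Real.exp (-x) *
        ((m + 1 : ℝ) * ∑' i : ℕ, x ^ (i + (m + 1)) / ((i + (m + 1)).factorial : ℝ)) := by ring
    _ ≤ Real.exp (-x) * (x * Real.exp x) := by
        refine mul_le_mul_of_nonneg_left (h3.trans ?_) (Real.exp_pos _).le
        exact mul_le_mul_of_nonneg_left (by linarith) hx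
    _ = x := by linear_combination x * h5

/-- Differentiation telescopes, leaving only the last term. After scaling, the tail is therefore a
primitive for the incomplete Gamma integrals below. -/
theorem hasDerivAt_poissonTail (M : ℕ) (x : ℝ) :
    HasDerivAt (poissonTail (M + 1)) (-(Real.exp (-x) * (x ^ M / (M.factorial : ℝ)))) x := by
  have he : HasDerivAt (fun y : ℝ => Real.exp (-y)) (-Real.exp (-x)) x := by
    simpa using (hasDerivAt_neg x).exp
  induction M with
  | zero =>
    have : poissonTail 1 = fun y => Real.exp (-y) := by funext y; simp [poissonTail]
    rw [this]
    simpa using he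
  | succ M ih =>
    have e : poissonTail (M + 1 + 1) = fun y => poissonTail (M + 1) y +
        Real.exp (-y) * (y ^ (M + 1) / ((M + 1).factorial : ℝ)) := by
      funext y; rw [poissonTail_succ]
    rw [e]
    have h := ih.add (he.mul ((hasDerivAt_pow (M + 1) x).div_const ((M + 1).factorial : ℝ)))
    refine h.congr_deriv ?_
    rw [Nat.factorial_succ]
    push_cast
    have : (M.factorial : ℝ) ≠ 0 := by positivity
    field_simp
    ring_nf

theorem tendsto_poissonTail (M : ℕ) : Tendsto (poissonTail M) atTop (nhds 0) := by
  have h : Tendsto (fun x : ℝ => 2 ^ M * Real.exp (-(x / 2))) atTop (nhds 0) := by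
    rw [← mul_zero ((2 : ℝ) ^ M)]
    refine Tendsto.const_mul _ (Real.tendsto_exp_neg_atTop_nhds_zero.comp ?_)
    exact tendsto_id.atTop_div_const (by norm_num)
  refine tendsto_of_tendsto_of_tendsto_of_le_of_le' tendsto_const_nhds h ?_ ?_
  · filter_upwards [eventually_ge_atTop 0] with x hx using poissonTail_nonneg M hx
  · filter_upwards [eventually_ge_atTop 0] with x hx using poissonTail_le M hx

theorem hasDerivAt_poissonTail_scaled (M : ℕ) {x : ℝ} (hx : 0 < x) (t : ℝ) :
    HasDerivAt (fun t => -((M.factorial : ℝ) / x ^ (M + 1) * poissonTail (M + 1) (x * t)))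
      (t ^ M * Real.exp (-x * t)) t := by
  have h := ((((hasDerivAt_poissonTail M (x * t)).comp t
    ((hasDerivAt_id t).const_mul x))).const_mul ((M.factorial : ℝ) / x ^ (M + 1))).neg
  refine h.congr_deriv ?_
  have : (M.factorial : ℝ) ≠ 0 := by positivity
  rw [← neg_mul]
  field_simp
  ring

theorem tendsto_poissonTail_scaled (M : ℕ) {x : ℝ} (hx : 0 < x) :
    Tendsto (fun t => -((M.factorial : ℝ) / x ^ (M + 1) * poissonTail (M + 1) (x * t)))
      atTop (nhds 0) := by
  have := (((tendsto_poissonTail (M + 1)).comp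
    (tendsto_id.const_mul_atTop hx)).const_mul ((M.factorial : ℝ) / x ^ (M + 1))).neg
  simpa using this

theorem integrableOn_pow_mul_exp_neg (M : ℕ) {x : ℝ} (hx : 0 < x) :
    IntegrableOn (fun t : ℝ => t ^ M * Real.exp (-x * t)) (Ioi 1) :=
  integrableOn_Ioi_deriv_of_nonneg' (fun t _ => hasDerivAt_poissonTail_scaled M hx t)
    (fun t ht => by have : (0 : ℝ) < t := lt_trans one_pos ht
                    positivity) (tendsto_poissonTail_scaled M hx)

theorem integral_pow_mul_exp_neg (M : ℕ) {x : ℝ} (hx : 0 < x) :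
    ∫ t in Ioi (1 : ℝ), t ^ M * Real.exp (-x * t)
      = (M.factorial : ℝ) / x ^ (M + 1) * poissonTail (M + 1) x := by
  rw [integral_Ioi_of_hasDerivAt_of_nonneg' (fun t _ => hasDerivAt_poissonTail_scaled M hx t)
    (fun t ht => by have : (0 : ℝ) < t := lt_trans one_pos ht
                    positivity) (tendsto_poissonTail_scaled M hx)]
  rw [mul_one]; ring

/-- The part of the theta series beyond `1`. -/
def thetaUpper (k : ℕ) : ℝ → ℂ := (Ioi 1).indicator (theta k)

/-- The substitution `t ↦ 1/t` carries the integral over `(0, 1)` to the one over `(1, ∞)`. -/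
theorem mellin_theta_center {k M : ℕ} (hk : k % 4 = 1) (hM : k + 1 = 2 * M) :
    mellin (theta k) M = 2 * mellin (thetaUpper k) M := by
  have hf := mellinConvergent_theta hk M
  have hg : MellinConvergent (thetaUpper k) M := by
    have : (fun t : ℝ => (t : ℂ) ^ ((M : ℂ) - 1) • thetaUpper k t)
        = (Ioi 1).indicator fun t : ℝ => (t : ℂ) ^ ((M : ℂ) - 1) • theta k t := by
      funext t
      by_cases h : t ∈ Ioi (1 : ℝ) <;> simp [thetaUpper, h]
    rw [MellinConvergent, this]
    exact IntegrableOn.indicator hf measurableSet_Ioi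
  have h1 := (hasMellin_sub hf hg).2
  have h2 : mellin (fun t => theta k t - thetaUpper k t) M
      = mellin (fun t => (t : ℂ) ^ (-((k + 1 : ℕ) : ℂ)) • thetaUpper k t⁻¹) M := by
    refine setIntegral_congr_ae measurableSet_Ioi ?_
    -- The two integrands may differ at `t = 1`, the endpoint left out of `thetaUpper`.
    have hne : ∀ᵐ t : ℝ, t ≠ 1 := by simp [ae_iff, measure_singleton]
    filter_upwards [hne] with t ht1 ht0
    have ht0 : 0 < t := ht0
    congr 1
    rcases lt_or_gt_of_ne ht1 with h | h
    · have h' : 1 < t⁻¹ := (one_lt_inv₀ ht0).mpr h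
      simp only [thetaUpper]
      rw [indicator_of_notMem (by simp [h.le]), indicator_of_mem (by simpa using h'), ← one_div,
        theta_functional_equation hk ht0, cpow_neg, cpow_natCast, smul_eq_mul, sub_zero,
        inv_mul_cancel_left₀]
      exact pow_ne_zero _ (by exact_mod_cast ht0.ne')
    · have h' : ¬ 1 < t⁻¹ := by rw [one_lt_inv₀ ht0]; exact h.le.not_gt
      simp only [thetaUpper]
      rw [indicator_of_mem (by simpa using h), indicator_of_notMem (by simpa using h')]
      simp
  rw [mellin_cpow_smul, mellin_comp_inv] at h2
  -- The central point is fixed by the reflection `s ↦ k + 1 - s`.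
  have h3 : -((M : ℂ) + -((k + 1 : ℕ) : ℂ)) = M := by rw [hM]; push_cast; ring
  rw [h3] at h2
  rw [h2] at h1
  linear_combination -h1

theorem mul_normForm_pos {p : ℤ × ℤ} (hp : p ≠ 0) :
    0 < 2 * Real.pi / 7 * (normForm p.1 p.2 : ℝ) := by
  have : (1 : ℝ) ≤ (normForm p.1 p.2 : ℝ) := by exact_mod_cast one_le_normForm hp
  positivity

/-- Integrated over `(1, ∞)`, each Gaussian term is an incomplete Gamma function of integer order,
i.e. a Poisson tail. The exponential bound on that tail justifies the exchange of sum and integral.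
-/
theorem hasSum_mellin_thetaUpper (k M : ℕ) :
    HasSum (fun p : ℤ × ℤ => (epsilon p.1 p.2 : ℂ) * latPt p ^ k *
      (((M.factorial : ℝ) / (2 * Real.pi / 7 * (normForm p.1 p.2 : ℝ)) ^ (M + 1) *
        poissonTail (M + 1) (2 * Real.pi / 7 * (normForm p.1 p.2 : ℝ)) : ℝ) : ℂ))
      (mellin (thetaUpper k) (M + 1 : ℕ)) := by
  set F : ℤ × ℤ → ℝ → ℂ := fun p t => (t : ℂ) ^ M * (thetaCoeff t p * latPt p ^ k) with hF
  have hFe : ∀ p t, F p t = ((epsilon p.1 p.2 : ℂ) * latPt p ^ k) *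
      ((t ^ M * Real.exp (-(2 * Real.pi / 7 * (normForm p.1 p.2 : ℝ)) * t) : ℝ) : ℂ) := by
    intro p t
    simp only [hF, thetaCoeff]
    rw [show -(2 * Real.pi / 7 * (normForm p.1 p.2 : ℝ)) * t
      = -(2 * Real.pi / 7 * t) * (normForm p.1 p.2 : ℝ) by ring]
    push_cast
    ring
  have hF0 : ∀ t, F 0 t = 0 := fun t => by simp [hF, thetaCoeff_zero]
  have hint : ∀ p, Integrable (F p) (volume.restrict (Ioi 1)) := by
    intro p
    rcases eq_or_ne p 0 with rfl | hp
    · simp [funext hF0]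
    · rw [funext (hFe p)]
      exact (Integrable.ofReal (integrableOn_pow_mul_exp_neg M (mul_normForm_pos hp))).const_mul _
  have hnorm : ∀ p, ∫ t in Ioi (1 : ℝ), ‖F p t‖ = ‖(epsilon p.1 p.2 : ℂ) * latPt p ^ k‖ *
      ((M.factorial : ℝ) / (2 * Real.pi / 7 * (normForm p.1 p.2 : ℝ)) ^ (M + 1) *
        poissonTail (M + 1) (2 * Real.pi / 7 * (normForm p.1 p.2 : ℝ))) := by
    intro p
    rcases eq_or_ne p 0 with rfl | hp
    · simp [hF0, epsilon_zero]
    · rw [← integral_pow_mul_exp_neg M (mul_normForm_pos hp), ← integral_const_mul]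
      refine setIntegral_congr_fun measurableSet_Ioi fun t ht => ?_
      have ht : (0 : ℝ) < t := lt_trans one_pos ht
      simp only [hFe, norm_mul, norm_real, Real.norm_eq_abs]
      rw [abs_of_pos (pow_pos ht M), Real.abs_exp]
  have hsum : Summable fun p => ∫ t in Ioi (1 : ℝ), ‖F p t‖ := by
    simp_rw [hnorm]
    refine Summable.of_nonneg_of_le (fun p => ?_) (fun p => ?_)
      ((summable_pow_norm_latPt k (c := 2 * Real.pi / 7 / 2) (by positivity)).mul_left
        ((M.factorial : ℝ) / (2 * Real.pi / 7) ^ (M + 1) * 2 ^ (M + 1)))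
    · have hN : (0 : ℝ) ≤ (normForm p.1 p.2 : ℝ) := by exact_mod_cast normForm_nonneg _ _
      have := poissonTail_nonneg (M + 1) (x := 2 * Real.pi / 7 * (normForm p.1 p.2 : ℝ))
        (by positivity)
      positivity
    rcases eq_or_ne p 0 with rfl | hp
    · simp only [Prod.fst_zero, Prod.snd_zero, epsilon_zero, Int.cast_zero, zero_mul, norm_zero]
      positivity
    · have hN : (1 : ℝ) ≤ (normForm p.1 p.2 : ℝ) := by exact_mod_cast one_le_normForm hp
      have h1 := poissonTail_le (M + 1) (mul_normForm_pos hp).le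
      have h0 := poissonTail_nonneg (M + 1) (mul_normForm_pos hp).le
      have h2 : ‖(epsilon p.1 p.2 : ℂ) * latPt p ^ k‖ ≤ ‖latPt p‖ ^ k := by
        rw [norm_mul, norm_pow]
        exact mul_le_of_le_one_left (by positivity) (norm_epsilon_le p)
      have h3 : (2 * Real.pi / 7) ^ (M + 1) ≤ (2 * Real.pi / 7 * (normForm p.1 p.2 : ℝ)) ^ (M + 1) := by
        gcongr
        exact le_mul_of_one_le_right (by positivity) hN
      calc _ ≤ ‖latPt p‖ ^ k * ((M.factorial : ℝ) / (2 * Real.pi / 7) ^ (M + 1) *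
            (2 ^ (M + 1) * Real.exp (-(2 * Real.pi / 7 * (normForm p.1 p.2 : ℝ) / 2)))) := by
            gcongr
        _ = _ := by
            rw [show -(2 * Real.pi / 7 * (normForm p.1 p.2 : ℝ) / 2)
              = -(2 * Real.pi / 7 / 2) * (normForm p.1 p.2 : ℝ) by ring]
            ring
  have h := hasSum_integral_of_summable_integral_norm hint hsum
  have hval : ∫ t in Ioi (1 : ℝ), ∑' p, F p t = mellin (thetaUpper k) (M + 1 : ℕ) := by
    have e : ∀ t : ℝ, (t : ℂ) ^ (((M + 1 : ℕ) : ℂ) - 1) • thetaUpper k t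
        = (Ioi 1).indicator (fun t => ∑' p, F p t) t := by
      intro t
      by_cases ht : t ∈ Ioi (1 : ℝ)
      · rw [thetaUpper, indicator_of_mem ht, indicator_of_mem ht, smul_eq_mul]
        simp only [hF]
        rw [tsum_mul_left, theta]
        push_cast
        rw [add_sub_cancel_right, cpow_natCast]
      · simp [thetaUpper, ht]
    rw [mellin, setIntegral_congr_fun measurableSet_Ioi (fun t _ => e t),
      setIntegral_indicator measurableSet_Ioi,
      inter_eq_self_of_subset_right (Ioi_subset_Ioi zero_le_one)]
  rw [hval] at h
  refine h.congr_fun fun p => ?_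
  rcases eq_or_ne p 0 with rfl | hp
  · simp [hF0, epsilon_zero]
  · simp only [hFe]
    rw [integral_const_mul, integral_complex_ofReal, integral_pow_mul_exp_neg M (mul_normForm_pos hp)]

/-- The central value as a rapidly convergent series. -/
theorem hasSum_heckeL_center {k M : ℕ} (hk : k % 4 = 1) (hM : k + 1 = 2 * M) :
    HasSum (fun p : ℤ × ℤ => (epsilon p.1 p.2 : ℂ) * latPt p ^ k / (normForm p.1 p.2 : ℂ) ^ M *
      (poissonTail M (2 * Real.pi / 7 * (normForm p.1 p.2 : ℝ)) : ℂ)) (heckeL k (1 / 2)) := by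
  obtain ⟨m, rfl⟩ : ∃ m, M = m + 1 := ⟨M - 1, by omega⟩
  rw [← (isHeckeLFunction_heckeEntire hk).eq_heckeL, heckeEntire,
    show (1 / 2 : ℂ) + (k : ℂ) / 2 = ((m + 1 : ℕ) : ℂ) by
      have : ((k + 1 : ℕ) : ℂ) = ((2 * (m + 1) : ℕ) : ℂ) := by rw [hM]
      push_cast at this ⊢
      linear_combination this / 2,
    mellin_theta_center hk hM, cpow_natCast]
  have hG : Gamma ((m + 1 : ℕ) : ℂ) = (m.factorial : ℂ) := by
    push_cast; exact Gamma_nat_eq_factorial m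
  rw [hG]
  have h := (hasSum_mellin_thetaUpper k m).mul_left
    (((2 * Real.pi / 7 : ℝ) : ℂ) ^ (m + 1) * (m.factorial : ℂ)⁻¹)
  have e : 1 / 2 * ((2 * Real.pi / 7 : ℝ) : ℂ) ^ (m + 1) * (m.factorial : ℂ)⁻¹ *
      (2 * mellin (thetaUpper k) (m + 1 : ℕ))
      = ((2 * Real.pi / 7 : ℝ) : ℂ) ^ (m + 1) * (m.factorial : ℂ)⁻¹ *
        mellin (thetaUpper k) (m + 1 : ℕ) := by ring
  rw [e]
  refine h.congr_fun fun p => ?_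
  rcases eq_or_ne p 0 with rfl | hp
  · simp [epsilon_zero]
  · have hf : (m.factorial : ℂ) ≠ 0 := by exact_mod_cast m.factorial_ne_zero
    have hN : (normForm p.1 p.2 : ℂ) ≠ 0 := by
      have := one_le_normForm hp
      exact_mod_cast (by omega : normForm p.1 p.2 ≠ 0)
    have hpi : (Real.pi : ℂ) ≠ 0 := by exact_mod_cast Real.pi_ne_zero
    generalize poissonTail (m + 1) (2 * Real.pi / 7 * (normForm p.1 p.2 : ℝ)) = Q
    push_cast
    field_simp
    rw [mul_div_right_comm, mul_pow]; ring

end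

/-! ### Geometry of the lattice: determinants, traces and harmonic sums. -/

section

open Complex

/-- The determinant of two lattice points. -/
def latDet (v w : ℤ × ℤ) : ℤ := v.1 * w.2 - v.2 * w.1

/-- The trace of `v * conj w`. -/
def latTr (v w : ℤ × ℤ) : ℤ := 2 * v.1 * w.1 + v.1 * w.2 + v.2 * w.1 + 4 * v.2 * w.2

/-- Multiplication by `-√-7`. -/
def latRot (v : ℤ × ℤ) : ℤ × ℤ := (v.1 + 4 * v.2, -(2 * v.1 + v.2))

/-- Multiplication by `√-7` exchanges, up to constants, the real and imaginary parts of `v conj w`.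
Sums over traces thereby reduce to sums over determinants. -/
theorem latDet_latRot (v w : ℤ × ℤ) : latDet (latRot v) w = latTr v w := by
  simp only [latDet, latRot, latTr]; ring

theorem normForm_latRot (v : ℤ × ℤ) :
    normForm (latRot v).1 (latRot v).2 = 7 * normForm v.1 v.2 := by
  simp only [normForm, latRot]; ring

theorem norm_latRot (v : ℤ × ℤ) : ‖latPt v‖ ≤ ‖latPt (latRot v)‖ := by
  refine le_of_sq_le_sq ?_ (norm_nonneg _)
  rw [norm_latPt_sq, norm_latPt_sq, normForm_latRot]
  have : (0 : ℝ) ≤ (normForm v.1 v.2 : ℝ) := by exact_mod_cast normForm_nonneg _ _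
  push_cast
  linarith

/-- A common divisor of the new coordinates divides both 7 and `2a + b`. -/
theorem isCoprime_latRot {v : ℤ × ℤ} (hv : IsCoprime v.1 v.2) (h7 : ¬ (7 : ℤ) ∣ 2 * v.1 + v.2) :
    IsCoprime (latRot v).1 (latRot v).2 := by
  obtain ⟨x, y, hxy⟩ := hv
  have h1 : IsCoprime (7 : ℤ) (2 * v.1 + v.2) :=
    (Int.prime_iff_natAbs_prime.mpr (by norm_num)).coprime_iff_not_dvd.mpr h7
  obtain ⟨s, t, hst⟩ := h1
  refine ⟨s * (2 * y - x), -(s * (4 * x - y) + t), ?_⟩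
  simp only [latRot]
  linear_combination hst + 7 * s * hxy

/-- Twice the trace is `uu' + 7vv'` in the coordinates `u = 2a + b`, `v = b`; its vanishing would
force 7 to divide `uu'`. -/
theorem latTr_ne_zero {v w : ℤ × ℤ} (hv : ¬ (7 : ℤ) ∣ 2 * v.1 + v.2)
    (hw : ¬ (7 : ℤ) ∣ 2 * w.1 + w.2) : latTr v w ≠ 0 := by
  intro h
  have h7 : Prime (7 : ℤ) := Int.prime_iff_natAbs_prime.mpr (by norm_num)
  have : (7 : ℤ) ∣ (2 * v.1 + v.2) * (2 * w.1 + w.2) :=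
    ⟨-(v.2 * w.2), by simp only [latTr] at h; linear_combination 2 * h⟩
  rcases h7.dvd_or_dvd this with h | h
  · exact hv h
  · exact hw h

/-- The nonzero lattice points of norm at most `X`. -/
def latticeBall (X : ℕ) : Finset (ℤ × ℤ) :=
  ((Finset.Icc (-(Nat.sqrt (2 * X) : ℤ)) (Nat.sqrt (2 * X))) ×ˢ
    (Finset.Icc (-(Nat.sqrt (2 * X) : ℤ)) (Nat.sqrt (2 * X)))).filter
    fun p => p ≠ 0 ∧ normForm p.1 p.2 ≤ X

theorem abs_le_sqrt_of_normForm_le {a b : ℤ} {X : ℕ} (h : normForm a b ≤ X) :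
    |a| ≤ Nat.sqrt (2 * X) ∧ |b| ≤ Nat.sqrt (2 * X) := by
  have key : ∀ c : ℤ, c ^ 2 ≤ 2 * X → |c| ≤ Nat.sqrt (2 * X) := by
    intro c hc
    rw [Int.abs_eq_natAbs]
    norm_cast
    rw [Nat.le_sqrt']
    have : ((c.natAbs ^ 2 : ℕ) : ℤ) ≤ ((2 * X : ℕ) : ℤ) := by
      push_cast; rw [sq_abs]; exact hc
    exact_mod_cast this
  simp only [normForm] at h
  exact ⟨key a (by nlinarith [sq_nonneg (a + b), sq_nonneg b]),
    key b (by nlinarith [sq_nonneg (a + b), sq_nonneg b])⟩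

theorem mem_latticeBall {X : ℕ} {p : ℤ × ℤ} :
    p ∈ latticeBall X ↔ p ≠ 0 ∧ normForm p.1 p.2 ≤ X := by
  simp only [latticeBall, Finset.mem_filter, Finset.mem_product, Finset.mem_Icc]
  refine ⟨fun h => h.2, fun h => ⟨?_, h⟩⟩
  have := abs_le_sqrt_of_normForm_le h.2
  rw [abs_le, abs_le] at this
  exact this

/-- The symmetric harmonic sum. -/
def harm (Z : ℕ) : ℝ := ∑ d ∈ Finset.Icc (-(Z : ℤ)) Z, 1 / max 1 |(d : ℝ)|

theorem harm_nonneg (Z : ℕ) : 0 ≤ harm Z :=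
  Finset.sum_nonneg fun d _ => by positivity

theorem harm_mono {Y Z : ℕ} (h : Y ≤ Z) : harm Y ≤ harm Z :=
  Finset.sum_le_sum_of_subset_of_nonneg (Finset.Icc_subset_Icc (by omega) (by omega))
    fun d _ _ => by positivity

theorem harm_le (Z : ℕ) : harm Z ≤ 4 + 2 * Real.log Z := by
  have hsub : Finset.Icc (-(Z : ℤ)) Z ⊆
      (Finset.range (Z + 1)).image (fun n : ℕ => (n : ℤ)) ∪
      (Finset.range (Z + 1)).image (fun n : ℕ => -(n : ℤ)) := by
    intro d hd
    rw [Finset.mem_Icc] at hd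
    simp only [Finset.mem_union, Finset.mem_image, Finset.mem_range]
    rcases le_total 0 d with h | h
    · left; exact ⟨d.toNat, by omega, by omega⟩
    · right; exact ⟨(-d).toNat, by omega, by omega⟩
  have h1 : ∑ n ∈ Finset.range (Z + 1), 1 / max 1 ((n : ℝ)) ≤ 2 + Real.log Z := by
    rw [Finset.sum_range_succ']
    have h2 := harmonic_le_one_add_log Z
    have h3 : ∑ n ∈ Finset.range Z, 1 / max 1 (((n + 1 : ℕ) : ℝ)) = (harmonic Z : ℝ) := by
      rw [harmonic]
      push_cast
      refine Finset.sum_congr rfl fun n _ => ?_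
      rw [max_eq_right (by linarith [(Nat.cast_nonneg n : (0 : ℝ) ≤ n)]), one_div]
    rw [h3]
    norm_num
    linarith
  have hpos : ∀ d : ℤ, 0 ≤ 1 / max 1 |(d : ℝ)| := fun d => by positivity
  calc harm Z ≤ ∑ d ∈ (Finset.range (Z + 1)).image (fun n : ℕ => (n : ℤ)) ∪
      (Finset.range (Z + 1)).image (fun n : ℕ => -(n : ℤ)), 1 / max 1 |(d : ℝ)| :=
        Finset.sum_le_sum_of_subset_of_nonneg hsub fun d _ _ => hpos d
    _ ≤ ∑ d ∈ (Finset.range (Z + 1)).image (fun n : ℕ => (n : ℤ)), 1 / max 1 |(d : ℝ)| +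
        ∑ d ∈ (Finset.range (Z + 1)).image (fun n : ℕ => -(n : ℤ)), 1 / max 1 |(d : ℝ)| := by
        rw [← Finset.sum_union_inter]
        linarith [Finset.sum_nonneg (s := (Finset.range (Z + 1)).image (fun n : ℕ => (n : ℤ)) ∩
          (Finset.range (Z + 1)).image (fun n : ℕ => -(n : ℤ))) fun d _ => hpos d]
    _ = ∑ n ∈ Finset.range (Z + 1), 1 / max 1 ((n : ℝ)) +
        ∑ n ∈ Finset.range (Z + 1), 1 / max 1 ((n : ℝ)) := by
        rw [Finset.sum_image (fun a _ b _ h => by simpa using h),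
          Finset.sum_image (fun a _ b _ h => by simpa using h)]
        simp
    _ ≤ 4 + 2 * Real.log Z := by linarith

theorem norm_latPt_pos {p : ℤ × ℤ} (hp : p ≠ 0) : 0 < ‖latPt p‖ := by
  have h := norm_latPt_sq p
  have h1 : (1 : ℝ) ≤ (normForm p.1 p.2 : ℝ) := by exact_mod_cast one_le_normForm hp
  rcases (norm_nonneg (latPt p)).lt_or_eq with h2 | h2
  · exact h2
  · rw [← h2] at h; norm_num at h; linarith

theorem norm_latPt_le_sqrt {p : ℤ × ℤ} {X : ℕ} (hp : p ∈ latticeBall X) :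
    ‖latPt p‖ ≤ Real.sqrt X := by
  refine Real.le_sqrt_of_sq_le ?_
  rw [norm_latPt_sq]
  exact_mod_cast (mem_latticeBall.mp hp).2

/-- Since `v` is primitive, the solutions `w` lie in one progression `w₀ + tv` with `t` an integer,
and the ball confines `t` to `|t| ≤ 2√X/|v|`. Norms up to `7X` are allowed so that the bound also
applies to `latRot v`. -/
theorem card_latDet_fiber_le {X : ℕ} {v : ℤ × ℤ} (hv0 : v ≠ 0) (hv : IsCoprime v.1 v.2)
    (hvX : normForm v.1 v.2 ≤ 7 * X) (d : ℤ) :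
    (((latticeBall X).filter fun w => latDet v w = d).card : ℝ) ≤ 7 * Real.sqrt X / ‖latPt v‖ := by
  have hpos := norm_latPt_pos hv0
  rcases ((latticeBall X).filter fun w => latDet v w = d).eq_empty_or_nonempty with he | ⟨w0, hw0⟩
  · rw [he]; simp; positivity
  obtain ⟨x, y, hxy⟩ := hv
  set T : ℕ := ⌊2 * Real.sqrt X / ‖latPt v‖⌋₊ with hT
  rw [Finset.mem_filter] at hw0
  have key : ∀ w ∈ (latticeBall X).filter fun w => latDet v w = d,
      w.1 - w0.1 = (x * (w.1 - w0.1) + y * (w.2 - w0.2)) * v.1 ∧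
      w.2 - w0.2 = (x * (w.1 - w0.1) + y * (w.2 - w0.2)) * v.2 := by
    intro w hw
    rw [Finset.mem_filter] at hw
    have h : v.1 * (w.2 - w0.2) = v.2 * (w.1 - w0.1) := by
      have h1 := hw.2; have h2 := hw0.2
      simp only [latDet] at h1 h2
      linear_combination h1 - h2
    constructor
    · linear_combination (-(w.1 - w0.1)) * hxy - y * h
    · linear_combination (-(w.2 - w0.2)) * hxy + x * h
  have hcard : ((latticeBall X).filter fun w => latDet v w = d).card
      ≤ (Finset.Icc (-(T : ℤ)) T).card := by
    refine Finset.card_le_card_of_injOn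
      (fun w => x * (w.1 - w0.1) + y * (w.2 - w0.2)) (fun w hw => ?_) (fun w hw w' hw' h => ?_)
    · obtain ⟨k1, k2⟩ := key w hw
      have hw' := Finset.mem_filter.mp hw
      set t := x * (w.1 - w0.1) + y * (w.2 - w0.2) with ht
      have e : latPt w - latPt w0 = (t : ℂ) * latPt v := by
        have k1' : (w.1 : ℂ) - w0.1 = t * v.1 := by exact_mod_cast k1
        have k2' : (w.2 : ℂ) - w0.2 = t * v.2 := by exact_mod_cast k2
        simp only [latPt]
        linear_combination k1' + eta * k2'
      have h1 : |(t : ℝ)| * ‖latPt v‖ ≤ 2 * Real.sqrt X := by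
        have h2 := norm_sub_le (latPt w) (latPt w0)
        rw [e, norm_mul, norm_intCast] at h2
        linarith [norm_latPt_le_sqrt hw'.1, norm_latPt_le_sqrt hw0.1]
      have h3 : |(t : ℝ)| ≤ 2 * Real.sqrt X / ‖latPt v‖ := (le_div_iff₀ hpos).mpr h1
      have h4 : t.natAbs ≤ T := by
        rw [hT]
        refine Nat.le_floor ?_
        rw [Nat.cast_natAbs]; push_cast; exact h3
      simp only [Finset.coe_Icc, Set.mem_Icc]
      omega
    · obtain ⟨k1, k2⟩ := key w hw
      obtain ⟨k1', k2'⟩ := key w' hw'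
      simp only at h
      rw [h] at k1 k2
      exact Prod.ext (by omega) (by omega)
  have hc2 : (Finset.Icc (-(T : ℤ)) T).card = 2 * T + 1 := by
    rw [Int.card_Icc]; omega
  rw [hc2] at hcard
  have h5 : (T : ℝ) ≤ 2 * Real.sqrt X / ‖latPt v‖ := Nat.floor_le (by positivity)
  -- Absorbs the `+1` of the count, using `|v|² ≤ 7X ≤ 9X`.
  have h6 : 1 ≤ 3 * Real.sqrt X / ‖latPt v‖ := by
    rw [le_div_iff₀ hpos, one_mul]
    refine le_of_sq_le_sq ?_ (by positivity)
    rw [norm_latPt_sq, mul_pow, Real.sq_sqrt (by positivity)]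
    have : (normForm v.1 v.2 : ℝ) ≤ 7 * X := by exact_mod_cast hvX
    have : (0 : ℝ) ≤ X := by positivity
    linarith
  calc _ ≤ ((2 * T + 1 : ℕ) : ℝ) := by exact_mod_cast hcard
    _ = 2 * T + 1 := by push_cast; ring
    _ ≤ 2 * (2 * Real.sqrt X / ‖latPt v‖) + 3 * Real.sqrt X / ‖latPt v‖ := by linarith
    _ = _ := by ring

theorem abs_latDet_le {X : ℕ} {v w : ℤ × ℤ} (hvX : normForm v.1 v.2 ≤ 7 * X)
    (hw : normForm w.1 w.2 ≤ X) : |latDet v w| ≤ 15 * X := by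
  simp only [normForm] at hvX hw
  simp only [latDet]
  rw [abs_le]
  constructor <;>
    nlinarith [sq_nonneg (v.1 + v.2), sq_nonneg (w.1 + w.2), sq_nonneg v.2, sq_nonneg w.2,
      sq_nonneg (v.1 - w.2), sq_nonneg (v.2 - w.1), sq_nonneg (v.1 + w.2), sq_nonneg (v.2 + w.1)]

/-- Sorting `w` by the value `d` of the determinant, each line carries `O(√X/|v|)` points, and the
weights `1/|d|` add up to a logarithm. -/
theorem sum_inv_latDet_le {X : ℕ} {v : ℤ × ℤ} (hv0 : v ≠ 0) (hv : IsCoprime v.1 v.2)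
    (hvX : normForm v.1 v.2 ≤ 7 * X) :
    ∑ w ∈ (latticeBall X).filter (fun w => latDet v w ≠ 0), 1 / |(latDet v w : ℝ)|
      ≤ 7 * Real.sqrt X / ‖latPt v‖ * harm (15 * X) := by
  rw [← Finset.sum_fiberwise_of_maps_to (g := latDet v)
    (t := Finset.Icc (-((15 * X : ℕ) : ℤ)) ((15 * X : ℕ) : ℤ)), harm, Finset.mul_sum]
  · refine Finset.sum_le_sum fun d _ => ?_
    have h1 : ∑ w ∈ ((latticeBall X).filter (fun w => latDet v w ≠ 0)).filter
        (fun w => latDet v w = d), 1 / |(latDet v w : ℝ)|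
        ≤ ∑ w ∈ (latticeBall X).filter (fun w => latDet v w = d), 1 / max 1 |(d : ℝ)| := by
      rw [Finset.filter_filter]
      refine le_trans (Finset.sum_le_sum fun w hw => ?_)
        (Finset.sum_le_sum_of_subset_of_nonneg (fun w hw => ?_) fun _ _ _ => by positivity)
      · rw [Finset.mem_filter] at hw
        rw [← hw.2.2]
        have : (1 : ℝ) ≤ |(latDet v w : ℝ)| := by exact_mod_cast Int.one_le_abs hw.2.1
        rw [max_eq_right this]
      · rw [Finset.mem_filter] at hw ⊢
        exact ⟨hw.1, hw.2.2⟩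
    refine h1.trans ?_
    rw [Finset.sum_const, nsmul_eq_mul]
    gcongr
    exact card_latDet_fiber_le hv0 hv hvX d
  · intro w hw
    rw [Finset.mem_filter] at hw
    have := abs_latDet_le hvX (mem_latticeBall.mp hw.1).2
    rw [abs_le] at this
    rw [Finset.mem_Icc]
    push_cast
    omega

theorem max_one_abs_le_norm {p : ℤ × ℤ} (hp : p ≠ 0) :
    max 1 |(p.1 : ℝ)| ≤ 2 * ‖latPt p‖ ∧ max 1 |(p.2 : ℝ)| ≤ 2 * ‖latPt p‖ := by
  have h := norm_latPt_sq p
  have h1 : (1 : ℝ) ≤ (normForm p.1 p.2 : ℝ) := by exact_mod_cast one_le_normForm hp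
  have h2 := half_sq_le_normForm p.1 p.2
  have hn := norm_nonneg (latPt p)
  refine ⟨max_le ?_ ?_, max_le ?_ ?_⟩
  · nlinarith
  · exact abs_le_of_sq_le_sq (by nlinarith [sq_nonneg (p.2 : ℝ)]) (by positivity)
  · nlinarith
  · exact abs_le_of_sq_le_sq (by nlinarith [sq_nonneg (p.1 : ℝ)]) (by positivity)

theorem sum_inv_norm_le (X : ℕ) :
    ∑ p ∈ latticeBall X, 1 / ‖latPt p‖ ≤
      2 * (2 * Nat.sqrt (2 * X) + 1) * harm (Nat.sqrt (2 * X)) := by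
  have h1 : ∑ p ∈ latticeBall X, 1 / ‖latPt p‖ ≤ ∑ p ∈ latticeBall X, 2 * (1 / max 1 |(p.2 : ℝ)|) := by
    refine Finset.sum_le_sum fun p hp => ?_
    have hp0 := (mem_latticeBall.mp hp).1
    have := (max_one_abs_le_norm hp0).2
    have h := norm_latPt_pos hp0
    rw [mul_one_div, div_le_div_iff₀ h (by positivity)]
    linarith
  refine h1.trans ((Finset.sum_le_sum_of_subset_of_nonneg (Finset.filter_subset _ _)
    fun _ _ _ => by positivity).trans ?_)
  rw [Finset.sum_product]
  dsimp only
  rw [Finset.sum_const, Int.card_Icc, nsmul_eq_mul, ← Finset.mul_sum, ← harm]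
  have : (((Nat.sqrt (2 * X) : ℤ) + 1 - -(Nat.sqrt (2 * X) : ℤ)).toNat : ℝ)
      = 2 * Nat.sqrt (2 * X) + 1 := by
    have : ((Nat.sqrt (2 * X) : ℤ) + 1 - -(Nat.sqrt (2 * X) : ℤ)).toNat = 2 * Nat.sqrt (2 * X) + 1 := by
      omega
    rw [this]; push_cast; ring
  rw [this]
  apply le_of_eq; ring

theorem sum_inv_norm_sq_le (X : ℕ) :
    ∑ p ∈ latticeBall X, 1 / ‖latPt p‖ ^ 2 ≤ 4 * harm (Nat.sqrt (2 * X)) ^ 2 := by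
  have h1 : ∑ p ∈ latticeBall X, 1 / ‖latPt p‖ ^ 2 ≤
      ∑ p ∈ latticeBall X, 4 * (1 / max 1 |(p.1 : ℝ)| * (1 / max 1 |(p.2 : ℝ)|)) := by
    refine Finset.sum_le_sum fun p hp => ?_
    have hp0 := (mem_latticeBall.mp hp).1
    obtain ⟨ha, hb⟩ := max_one_abs_le_norm hp0
    have h := norm_latPt_pos hp0
    rw [one_div_mul_one_div, mul_one_div, div_le_div_iff₀ (by positivity) (by positivity)]
    have := mul_le_mul ha hb (by positivity) (by positivity)
    nlinarith
  refine h1.trans ((Finset.sum_le_sum_of_subset_of_nonneg (Finset.filter_subset _ _)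
    fun _ _ _ => by positivity).trans ?_)
  rw [← Finset.mul_sum, Finset.sum_product]
  simp_rw [← Finset.mul_sum]
  rw [← Finset.sum_mul, ← harm]
  apply le_of_eq; ring

end

/-! ### Partial summation and bounded variation. -/

section

open Complex

/-- Abel summation against the geometric partial sums, each of size at most `2/|1 - z|`. -/
theorem norm_sum_mul_pow_le {c : ℕ → ℝ} {A V : ℝ} {z : ℂ} (hz : ‖z‖ = 1) (hz1 : z ≠ 1)
    (hA : ∀ i, |c i| ≤ A) (hV : ∀ n, ∑ i ∈ Finset.range n, |c (i + 1) - c i| ≤ V) (n : ℕ) :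
    ‖∑ i ∈ Finset.range n, (c i : ℂ) * z ^ i‖ ≤ 2 / ‖1 - z‖ * (A + V) := by
  set G : ℕ → ℂ := fun n => ∑ i ∈ Finset.range n, z ^ i with hG
  have hne : 0 < ‖1 - z‖ := norm_pos_iff.mpr (sub_ne_zero.mpr (Ne.symm hz1))
  have hGn : ∀ n, ‖G n‖ ≤ 2 / ‖1 - z‖ := by
    intro n
    simp only [hG]
    rw [geom_sum_eq hz1, norm_div, norm_sub_rev z 1]
    gcongr
    refine (norm_sub_le _ _).trans ?_
    rw [norm_pow, hz]; norm_num
  have key : ∀ n, ∑ i ∈ Finset.range n, (c i : ℂ) * z ^ i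
      = c n * G n - ∑ i ∈ Finset.range n, ((c (i + 1) - c i : ℝ) : ℂ) * G (i + 1) := by
    intro n
    induction n with
    | zero => simp [hG]
    | succ n ih =>
      have : G (n + 1) = G n + z ^ n := Finset.sum_range_succ _ _
      rw [Finset.sum_range_succ, ih, Finset.sum_range_succ, this]
      push_cast; ring
  rw [key]
  refine (norm_sub_le _ _).trans ?_
  rw [mul_add]
  refine add_le_add ?_ ?_
  · rw [norm_mul, norm_real, Real.norm_eq_abs, mul_comm]
    exact mul_le_mul (hGn n) (hA n) (abs_nonneg _) (by positivity)
  · refine (norm_sum_le _ _).trans (le_trans ?_ (mul_le_mul_of_nonneg_left (hV n) (by positivity)))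
    rw [Finset.mul_sum]
    refine Finset.sum_le_sum fun i _ => ?_
    rw [norm_mul, norm_real, Real.norm_eq_abs, mul_comm]
    exact mul_le_mul_of_nonneg_right (hGn _) (abs_nonneg _)

theorem variation_mul_le {c d : ℕ → ℝ} {A V : ℝ}
    (hcA : ∀ i, |c i| ≤ A) (hcV : ∀ n, ∑ i ∈ Finset.range n, |c (i + 1) - c i| ≤ V)
    (hdA : ∀ i, |d i| ≤ A) (hdV : ∀ n, ∑ i ∈ Finset.range n, |d (i + 1) - d i| ≤ V) (n : ℕ) :
    ∑ i ∈ Finset.range n, |c (i + 1) * d (i + 1) - c i * d i| ≤ 2 * A * V := by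
  have hA : 0 ≤ A := (abs_nonneg _).trans (hcA 0)
  have h : ∀ i, |c (i + 1) * d (i + 1) - c i * d i| ≤
      A * |d (i + 1) - d i| + A * |c (i + 1) - c i| := by
    intro i
    rw [show c (i + 1) * d (i + 1) - c i * d i
      = c (i + 1) * (d (i + 1) - d i) + d i * (c (i + 1) - c i) by ring]
    refine (abs_add_le _ _).trans ?_
    rw [abs_mul, abs_mul]
    gcongr
    · exact hcA _
    · exact hdA _
  refine (Finset.sum_le_sum fun i _ => h i).trans ?_
  rw [Finset.sum_add_distrib, ← Finset.mul_sum, ← Finset.mul_sum]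
  nlinarith [mul_le_mul_of_nonneg_left (hcV n) hA, mul_le_mul_of_nonneg_left (hdV n) hA]

/-- The symbols `1, 1, -1, 1, -1, -1, 0` have partial sums `1, 2, 1, 2, 1, 0, 0`, and then repeat.
That none is negative is what makes the amplitude of the ray of `1` positive. -/
theorem sum_legendreSym_seven_mem (n : ℕ) :
    0 ≤ ∑ m ∈ Finset.range n, (legendreSym 7 ((m : ℤ) + 1) : ℝ) ∧
      ∑ m ∈ Finset.range n, (legendreSym 7 ((m : ℤ) + 1) : ℝ) ≤ 2 := by
  have v : legendreSym 7 1 = 1 ∧ legendreSym 7 2 = 1 ∧ legendreSym 7 3 = -1 ∧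
    legendreSym 7 4 = 1 ∧ legendreSym 7 5 = -1 ∧ legendreSym 7 6 = -1 ∧ legendreSym 7 0 = 0 := by
    decide
  obtain ⟨v1, v2, v3, v4, v5, v6, v0⟩ := v
  have h : ∑ m ∈ Finset.range n, legendreSym 7 ((m : ℤ) + 1) =
      if n % 7 = 0 then 0 else if n % 7 = 1 then 1 else if n % 7 = 2 then 2 else
      if n % 7 = 3 then 1 else if n % 7 = 4 then 2 else if n % 7 = 5 then 1 else 0 := by
    induction n with
    | zero => simp
    | succ n ih =>
      rw [Finset.sum_range_succ, ih, legendreSym.mod]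
      have h7 : n % 7 < 7 := Nat.mod_lt _ (by norm_num)
      have e : (((n : ℤ) + 1) % ((7 : ℕ) : ℤ)) = ((((n % 7) + 1) % 7 : ℕ) : ℤ) := by
        push_cast; omega
      have e2 : (n + 1) % 7 = (n % 7 + 1) % 7 := by omega
      rw [e, e2]
      generalize n % 7 = r at *
      interval_cases r <;> norm_num [v0, v1, v2, v3, v4, v5, v6]
  have h' : ∑ m ∈ Finset.range n, (legendreSym 7 ((m : ℤ) + 1) : ℝ)
      = ((∑ m ∈ Finset.range n, legendreSym 7 ((m : ℤ) + 1) : ℤ) : ℝ) := by push_cast; rfl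
  rw [h', h]
  split_ifs <;> norm_num

theorem sum_mul_antitone_le {c w : ℕ → ℝ}
    (hc : ∀ n, 0 ≤ ∑ m ∈ Finset.range n, c m ∧ ∑ m ∈ Finset.range n, c m ≤ 2)
    (hw : Antitone w) (hw0 : ∀ n, 0 ≤ w n) (n : ℕ) :
    0 ≤ ∑ m ∈ Finset.range n, c m * w m ∧ ∑ m ∈ Finset.range n, c m * w m ≤ 2 * w 0 := by
  have key : (∑ m ∈ Finset.range n, c m) * w n ≤ ∑ m ∈ Finset.range n, c m * w m ∧
      ∑ m ∈ Finset.range n, c m * w m ≤ 2 * w 0 - (2 - ∑ m ∈ Finset.range n, c m) * w n := by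
    induction n with
    | zero => simp
    | succ n ih =>
      have h1 := hc (n + 1)
      have h2 : w (n + 1) ≤ w n := hw (Nat.le_succ n)
      rw [Finset.sum_range_succ (fun m => c m * w m)]
      have h3 : ∑ m ∈ Finset.range (n + 1), c m = ∑ m ∈ Finset.range n, c m + c n :=
        Finset.sum_range_succ _ _
      have e : (∑ m ∈ Finset.range (n + 1), c m) * w n
          = (∑ m ∈ Finset.range n, c m) * w n + c n * w n := by rw [h3]; ring
      constructor
      · linarith [mul_le_mul_of_nonneg_left h2 h1.1]
      · linarith [mul_le_mul_of_nonneg_left h2 (sub_nonneg.mpr h1.2)]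
  exact ⟨(mul_nonneg (hc n).1 (hw0 n)).trans key.1,
    key.2.trans (sub_le_self _ (mul_nonneg (sub_nonneg.mpr (hc n).2) (hw0 n)))⟩

/-- After summation by parts every term is nonnegative, and the first one is `w 0 - w 1`. -/
theorem sub_le_sum_mul_antitone {c w : ℕ → ℝ} (hc0 : c 0 = 1)
    (hc : ∀ n, 0 ≤ ∑ m ∈ Finset.range n, c m)
    (hw : Antitone w) (hw0 : ∀ n, 0 ≤ w n) (n : ℕ) :
    w 0 - w 1 ≤ ∑ m ∈ Finset.range (n + 1), c m * w m := by
  have key : w 0 - w 1 + (∑ m ∈ Finset.range (n + 1), c m) * w (n + 1) ≤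
      ∑ m ∈ Finset.range (n + 1), c m * w m := by
    induction n with
    | zero => simp [hc0]
    | succ n ih =>
      have h1 := hc (n + 1 + 1)
      have h2 : w (n + 1 + 1) ≤ w (n + 1) := hw (Nat.le_succ (n + 1))
      rw [Finset.sum_range_succ (fun m => c m * w m)]
      have h3 : ∑ m ∈ Finset.range (n + 1 + 1), c m = ∑ m ∈ Finset.range (n + 1), c m + c (n + 1) :=
        Finset.sum_range_succ _ _
      have e : (∑ m ∈ Finset.range (n + 1 + 1), c m) * w (n + 1)
          = (∑ m ∈ Finset.range (n + 1), c m) * w (n + 1) + c (n + 1) * w (n + 1) := by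
        rw [h3]; ring
      linarith [mul_le_mul_of_nonneg_left h2 h1]
  have := mul_nonneg (hc (n + 1)) (hw0 (n + 1))
  linarith

/-! ### Weights, amplitudes and phases of rays. -/

theorem poissonTail_antitoneOn (M : ℕ) : AntitoneOn (poissonTail (M + 1)) (Set.Ici 0) := by
  refine antitoneOn_of_deriv_nonpos (convex_Ici 0)
    (fun x _ => (hasDerivAt_poissonTail M x).continuousAt.continuousWithinAt)
    (fun x _ => (hasDerivAt_poissonTail M x).differentiableAt.differentiableWithinAt) fun x hx => ?_
  rw [interior_Ici] at hx
  have hx : 0 < x := hx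
  rw [(hasDerivAt_poissonTail M x).deriv, neg_nonpos]
  positivity

/-- The weight of `(m + 1) δ` on the ray of a lattice point `δ` of norm `ν`. -/
def rayWeight (X : ℕ) (ν : ℤ) (M m : ℕ) : ℝ :=
  if ((m : ℤ) + 1) ^ 2 * ν ≤ X then
    1 / ((m : ℝ) + 1) * poissonTail M (2 * Real.pi / 7 * (((m : ℝ) + 1) ^ 2 * (ν : ℝ))) else 0

/-- The amplitude of the ray of a lattice point of norm `ν`. -/
def rayAmp (X : ℕ) (ν : ℤ) (M : ℕ) : ℝ :=
  ∑ m ∈ Finset.range X, (legendreSym 7 ((m : ℤ) + 1) : ℝ) * rayWeight X ν M m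

theorem rayWeight_nonneg (X : ℕ) {ν : ℤ} (hν : 1 ≤ ν) (M m : ℕ) : 0 ≤ rayWeight X ν M m := by
  have : (1 : ℝ) ≤ ν := by exact_mod_cast hν
  unfold rayWeight
  split_ifs
  · exact mul_nonneg (by positivity) (poissonTail_nonneg _ (by positivity))
  · exact le_rfl

theorem rayWeight_le (X : ℕ) {ν : ℤ} (hν : 1 ≤ ν) (M m : ℕ) :
    rayWeight X ν M m ≤ 1 / ((m : ℝ) + 1) := by
  have : (1 : ℝ) ≤ ν := by exact_mod_cast hν
  unfold rayWeight
  split_ifs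
  · exact mul_le_of_le_one_right (by positivity) (poissonTail_le_one _ (by positivity))
  · positivity

theorem antitone_rayWeight (X : ℕ) {ν : ℤ} (hν : 1 ≤ ν) (M : ℕ) :
    Antitone (rayWeight X ν (M + 1)) := by
  have hν' : (1 : ℝ) ≤ ν := by exact_mod_cast hν
  refine antitone_nat_of_succ_le fun m => ?_
  by_cases h : (((m + 1 : ℕ) : ℤ) + 1) ^ 2 * ν ≤ X
  · have h' : ((m : ℤ) + 1) ^ 2 * ν ≤ X := by
      refine le_trans ?_ h
      push_cast
      have : (0 : ℤ) ≤ m := by positivity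
      nlinarith
    unfold rayWeight
    rw [if_pos h, if_pos h']
    have hm : (m : ℝ) + 1 ≤ ((m + 1 : ℕ) : ℝ) + 1 := by push_cast; linarith
    have h0 : 0 ≤ poissonTail (M + 1) (2 * Real.pi / 7 * ((((m + 1 : ℕ) : ℝ) + 1) ^ 2 * (ν : ℝ))) :=
      poissonTail_nonneg _ (by positivity)
    refine mul_le_mul (one_div_le_one_div_of_le (by positivity) hm) ?_ h0 (by positivity)
    refine poissonTail_antitoneOn M (Set.mem_Ici.mpr (by positivity))
      (Set.mem_Ici.mpr (by positivity)) ?_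
    gcongr
  · rw [show rayWeight X ν (M + 1) (m + 1) = 0 by unfold rayWeight; rw [if_neg h]]
    exact rayWeight_nonneg X hν _ m

theorem abs_rayAmp_le (X : ℕ) {ν : ℤ} (hν : 1 ≤ ν) (M : ℕ) : |rayAmp X ν (M + 1)| ≤ 2 := by
  have h := sum_mul_antitone_le sum_legendreSym_seven_mem (antitone_rayWeight X hν M)
    (rayWeight_nonneg X hν _) X
  have h1 := rayWeight_le X hν (M + 1) 0
  norm_num at h1
  rw [rayAmp, abs_of_nonneg h.1]
  linarith [h.2]

/-- The first weight is at least `3/4` by Markov's inequality, because `2π/7 < 1` and `M ≥ 4`, and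
the second is at most `1/2`. -/
theorem rayAmp_one_ge {X M : ℕ} (hX : 1 ≤ X) (hM : 4 ≤ M) : 1 / 4 ≤ rayAmp X 1 M := by
  obtain ⟨m, rfl⟩ : ∃ m, M = m + 1 := ⟨M - 1, by omega⟩
  obtain ⟨Y, rfl⟩ : ∃ Y, X = Y + 1 := ⟨X - 1, by omega⟩
  have h := sub_le_sum_mul_antitone (c := fun m : ℕ => (legendreSym 7 ((m : ℤ) + 1) : ℝ))
    (by have : legendreSym 7 1 = 1 := by decide
        simp [this])
    (fun n => (sum_legendreSym_seven_mem n).1) (antitone_rayWeight (Y + 1) le_rfl m)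
    (rayWeight_nonneg (Y + 1) le_rfl _) Y
  have h1 := rayWeight_le (Y + 1) (le_refl (1 : ℤ)) (m + 1) 1
  have h0 : rayWeight (Y + 1) 1 (m + 1) 0 = poissonTail (m + 1) (2 * Real.pi / 7) := by
    unfold rayWeight
    rw [if_pos (by push_cast; nlinarith)]
    norm_num
  have h2 := one_sub_poissonTail_le m (x := 2 * Real.pi / 7) (by positivity)
  have h3 : 2 * Real.pi / 7 / ((m : ℝ) + 1) ≤ 1 / 4 := by
    have : (4 : ℝ) ≤ (m : ℝ) + 1 := by exact_mod_cast hM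
    rw [div_le_div_iff₀ (by positivity) (by norm_num)]
    nlinarith [Real.pi_lt_d2]
  rw [rayAmp]
  norm_num at h1
  linarith

/-- Each weight increases with the Poisson cutoff, so its variation telescopes to a total increment,
which Markov's inequality bounds. Adding over the multiples inside the ball gives at most `(2π/7) ·
20N/(2N + 1) < 9`. -/
theorem sum_abs_rayAmp_sub_le {X : ℕ} {ν : ℤ} (hν : 1 ≤ ν) {N : ℕ} (hX : X ≤ 20 * N) (n : ℕ) :
    ∑ i ∈ Finset.range n, |rayAmp X ν (2 * (N + (i + 1)) + 1) - rayAmp X ν (2 * (N + i) + 1)| ≤ 9 := by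
  have hν' : (1 : ℝ) ≤ ν := by exact_mod_cast hν
  have hwm : ∀ i m, 0 ≤ rayWeight X ν (2 * (N + (i + 1)) + 1) m - rayWeight X ν (2 * (N + i) + 1) m := by
    intro i m
    unfold rayWeight
    split_ifs
    · rw [← mul_sub]
      refine mul_nonneg (by positivity) (sub_nonneg.mpr (poissonTail_mono (by positivity) ?_))
      omega
    · simp
  have h1 : ∀ i, |rayAmp X ν (2 * (N + (i + 1)) + 1) - rayAmp X ν (2 * (N + i) + 1)| ≤
      ∑ m ∈ Finset.range X,
        (rayWeight X ν (2 * (N + (i + 1)) + 1) m - rayWeight X ν (2 * (N + i) + 1) m) := by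
    intro i
    rw [rayAmp, rayAmp, ← Finset.sum_sub_distrib]
    refine (Finset.abs_sum_le_sum_abs _ _).trans (Finset.sum_le_sum fun m _ => ?_)
    rw [← mul_sub, abs_mul, abs_of_nonneg (hwm i m)]
    refine mul_le_of_le_one_left (hwm i m) ?_
    rcases quadraticChar_isQuadratic (ZMod 7) (((m : ℤ) + 1 : ℤ) : ZMod 7) with h | h | h <;>
      simp only [legendreSym, h] <;> norm_num
  refine (Finset.sum_le_sum fun i _ => h1 i).trans ?_
  rw [Finset.sum_comm]
  set s : ℝ := Real.sqrt (X / ν) with hs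
  have hs2 : s ^ 2 = X / ν := Real.sq_sqrt (by positivity)
  have h2 : ∀ m ∈ Finset.range X, ∑ i ∈ Finset.range n,
      (rayWeight X ν (2 * (N + (i + 1)) + 1) m - rayWeight X ν (2 * (N + i) + 1) m) ≤
      -- Only multiples `m + 1 ≤ s` survive the truncation; the factor `1/(m + 1)` cancels one power
      -- of the `(m + 1)²` in the mean, and the remaining one is at most `s`.
      if m ∈ Finset.range ⌊s⌋₊ then s * (2 * Real.pi / 7 * ν / (2 * N + 1)) else 0 := by
    intro m _
    rw [Finset.sum_range_sub (fun i => rayWeight X ν (2 * (N + i) + 1) m)]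
    by_cases h : ((m : ℤ) + 1) ^ 2 * ν ≤ X
    · have hms : (m : ℝ) + 1 ≤ s := by
        refine Real.le_sqrt_of_sq_le ?_
        rw [le_div_iff₀ (by positivity)]
        exact_mod_cast h
      have hm : m ∈ Finset.range ⌊s⌋₊ := by
        rw [Finset.mem_range, Nat.lt_iff_add_one_le]
        refine Nat.le_floor ?_
        push_cast; exact hms
      rw [if_pos hm]
      unfold rayWeight
      rw [if_pos h, if_pos h, ← mul_sub]
      have hy : 0 ≤ 2 * Real.pi / 7 * (((m : ℝ) + 1) ^ 2 * (ν : ℝ)) := by positivity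
      have h3 := poissonTail_le_one (2 * (N + n) + 1) hy
      have h4 := one_sub_poissonTail_le (2 * (N + 0)) hy
      calc _ ≤ 1 / ((m : ℝ) + 1) *
            (2 * Real.pi / 7 * (((m : ℝ) + 1) ^ 2 * (ν : ℝ)) / (((2 * (N + 0) : ℕ) : ℝ) + 1)) := by
            gcongr; linarith
        _ = ((m : ℝ) + 1) * (2 * Real.pi / 7 * ν / (2 * N + 1)) := by
            push_cast; field_simp; ring
        _ ≤ _ := by gcongr
    · unfold rayWeight
      rw [if_neg h, if_neg h]
      split_ifs
      · simp; positivity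
      · simp
  refine (Finset.sum_le_sum h2).trans ?_
  rw [← Finset.sum_filter]
  refine (Finset.sum_le_sum_of_subset_of_nonneg (t := Finset.range ⌊s⌋₊)
    (fun m hm => (Finset.mem_filter.mp hm).2) fun _ _ _ => by positivity).trans ?_
  rw [Finset.sum_const, Finset.card_range, nsmul_eq_mul]
  have hfl : (⌊s⌋₊ : ℝ) ≤ s := Nat.floor_le (Real.sqrt_nonneg _)
  have hX' : (X : ℝ) ≤ 20 * N := by exact_mod_cast hX
  calc (⌊s⌋₊ : ℝ) * (s * (2 * Real.pi / 7 * ν / (2 * N + 1)))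
      ≤ s * (s * (2 * Real.pi / 7 * ν / (2 * N + 1))) := by gcongr
    _ = s ^ 2 * (2 * Real.pi / 7 * ν / (2 * N + 1)) := by ring
    _ = X * (2 * Real.pi / 7) / (2 * N + 1) := by rw [hs2]; field_simp
    _ ≤ 9 := by
        rw [div_le_iff₀ (by positivity)]
        have : (0 : ℝ) ≤ N := by positivity
        have : (0 : ℝ) ≤ X := by positivity
        nlinarith [Real.pi_lt_d2, Real.pi_pos]

/-- The fourth power of the direction of a lattice point. -/
def rayPhase (p : ℤ × ℤ) : ℂ := (latPt p / ‖latPt p‖) ^ 4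

theorem norm_rayPhase {p : ℤ × ℤ} (hp : p ≠ 0) : ‖rayPhase p‖ = 1 := by
  have := norm_latPt_pos hp
  rw [rayPhase, norm_pow, norm_div, norm_real, norm_norm, div_self this.ne', one_pow]

theorem latPt_re (p : ℤ × ℤ) : (latPt p).re = p.1 + p.2 / 2 := by
  simp [latPt, eta]; ring

theorem latPt_im (p : ℤ × ℤ) : (latPt p).im = Real.sqrt 7 / 2 * p.2 := by
  simp [latPt, eta]; ring

/-- With `γ = p conj q`, the product of phases is `γ²/conj(γ)²`, so its distance to 1 is `4|Re γ ·
Im γ|/|γ|²`. Here `Re γ` is half the trace and `Im γ` is `-√7/2` times the determinant; `|γ| ≤ |Re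
γ| + |Im γ|` splits the reciprocal into two terms. -/
theorem rayPhase_sep {p q : ℤ × ℤ} (hp : p ≠ 0) (hq : q ≠ 0) (hd : latDet p q ≠ 0)
    (ht : latTr p q ≠ 0) :
    rayPhase p * (starRingEnd ℂ) (rayPhase q) ≠ 1 ∧
    2 / ‖1 - rayPhase p * (starRingEnd ℂ) (rayPhase q)‖ ≤
      ‖latPt p‖ * ‖latPt q‖ * (1 / |(latTr p q : ℝ)| + 1 / |(latDet p q : ℝ)|) := by
  have h7 : Real.sqrt 7 * Real.sqrt 7 = 7 := Real.mul_self_sqrt (by norm_num)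
  have h2 : (2 : ℝ) ≤ Real.sqrt 7 := Real.le_sqrt_of_sq_le (by norm_num)
  set γ := latPt p * (starRingEnd ℂ) (latPt q) with hγ
  have hn : ‖γ‖ = ‖latPt p‖ * ‖latPt q‖ := by rw [hγ, norm_mul, norm_conj]
  have hpos : 0 < ‖γ‖ := by
    rw [hn]; exact mul_pos (norm_latPt_pos hp) (norm_latPt_pos hq)
  have hre : γ.re = (latTr p q : ℝ) / 2 := by
    rw [hγ, mul_re, conj_re, conj_im, latPt_re, latPt_re, latPt_im, latPt_im, latTr]
    push_cast
    linear_combination (p.2 * q.2 / 4 : ℝ) * h7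
  have him : γ.im = -(Real.sqrt 7 / 2 * (latDet p q : ℝ)) := by
    rw [hγ, mul_im, conj_re, conj_im, latPt_re, latPt_re, latPt_im, latPt_im, latDet]
    push_cast
    ring
  have hγ0 : (starRingEnd ℂ) γ ≠ 0 := by
    rw [Ne, map_eq_zero, ← norm_eq_zero]; exact hpos.ne'
  have hγ1 : γ ≠ 0 := by rw [Ne, ← norm_eq_zero]; exact hpos.ne'
  have hphase : rayPhase p * (starRingEnd ℂ) (rayPhase q) = γ ^ 2 / (starRingEnd ℂ) γ ^ 2 := by
    have e1 : rayPhase p * (starRingEnd ℂ) (rayPhase q) = γ ^ 4 / (‖γ‖ : ℂ) ^ 4 := by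
      rw [hn, rayPhase, rayPhase, hγ]
      simp only [map_pow, map_div₀, conj_ofReal]
      push_cast
      rw [div_pow, div_pow, div_mul_div_comm, mul_pow, mul_pow]
    have e2 : (‖γ‖ : ℂ) ^ 4 = γ ^ 2 * (starRingEnd ℂ) γ ^ 2 := by
      rw [← mul_pow, mul_conj, normSq_eq_norm_sq]; push_cast; ring
    rw [e1, e2]
    field_simp
  have hdiff : 1 - rayPhase p * (starRingEnd ℂ) (rayPhase q)
      = -(4 * γ.re * γ.im * I) / (starRingEnd ℂ) γ ^ 2 := by
    rw [hphase, one_sub_div (pow_ne_zero 2 hγ0)]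
    congr 1
    have a1 := add_conj γ
    have a2 := sub_conj γ
    push_cast at a1 a2
    linear_combination -((starRingEnd ℂ) γ + γ) * a2 - (2 * (γ.im : ℂ) * I) * a1
  have hT : 0 < |(latTr p q : ℝ)| := abs_pos.mpr (by exact_mod_cast ht)
  have hD : 0 < |(latDet p q : ℝ)| := abs_pos.mpr (by exact_mod_cast hd)
  have hnorm : ‖1 - rayPhase p * (starRingEnd ℂ) (rayPhase q)‖
      = Real.sqrt 7 * |(latTr p q : ℝ)| * |(latDet p q : ℝ)| / ‖γ‖ ^ 2 := by
    rw [hdiff, norm_div, norm_pow, norm_conj, norm_neg]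
    simp only [norm_mul, norm_real, norm_I, Real.norm_eq_abs, mul_one]
    rw [hre, him, abs_div, abs_neg, abs_mul, abs_of_pos (show 0 < Real.sqrt 7 / 2 by positivity)]
    norm_num
    ring
  constructor
  · intro h
    rw [h, sub_self, norm_zero] at hnorm
    have : 0 < Real.sqrt 7 * |(latTr p q : ℝ)| * |(latDet p q : ℝ)| / ‖γ‖ ^ 2 := by positivity
    linarith
  rw [hnorm, ← hn]
  have hγle : ‖γ‖ ≤ |(latTr p q : ℝ)| / 2 + Real.sqrt 7 / 2 * |(latDet p q : ℝ)| := by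
    have := norm_le_abs_re_add_abs_im γ
    rwa [hre, him, abs_div, abs_neg, abs_mul, abs_of_pos (show 0 < Real.sqrt 7 / 2 by positivity),
      abs_two] at this
  rw [div_div_eq_mul_div, div_add_div _ _ hT.ne' hD.ne', ← mul_div_assoc,
    div_le_div_iff₀ (by positivity) (by positivity)]
  have : 0 < ‖γ‖ * |(latTr p q : ℝ)| * |(latDet p q : ℝ)| := by positivity
  have key : 2 * ‖γ‖ ≤ Real.sqrt 7 * (|(latDet p q : ℝ)| + |(latTr p q : ℝ)|) := by nlinarith
  nlinarith [mul_le_mul_of_nonneg_left key this.le]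

end

/-! ### Central values as sums over rays; the first moment. -/

section

open Complex

/-- The coefficient attached to a lattice point. -/
def rayCoeff (p : ℤ × ℤ) : ℂ := (epsilon p.1 p.2 : ℂ) * (latPt p / (‖latPt p‖ : ℂ) ^ 2)

/-- The term of a lattice point in the series for `L(1/2, χ^(4j+1))`. -/
def centerTerm (j : ℕ) (p : ℤ × ℤ) : ℂ :=
  rayCoeff p * rayPhase p ^ j *
    (poissonTail (2 * j + 1) (2 * Real.pi / 7 * (normForm p.1 p.2 : ℝ)) : ℂ)

/-- Rests on `α^(4j+1)/|α|^(4j+2) = (α/|α|²)(α/|α|)^(4j)`: the dependence on `j` is a pure phase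
times a Poisson tail. -/
theorem hasSum_centerTerm (j : ℕ) : HasSum (centerTerm j) (heckeL (4 * j + 1) (1 / 2)) := by
  refine (hasSum_heckeL_center (k := 4 * j + 1) (M := 2 * j + 1) (by omega) (by omega)).congr_fun
    fun p => ?_
  rw [centerTerm, rayCoeff, rayPhase]
  congr 1
  rcases eq_or_ne p 0 with rfl | hp
  · simp [epsilon_zero]
  have h : (normForm p.1 p.2 : ℂ) = (‖latPt p‖ : ℂ) ^ 2 := by
    exact_mod_cast congrArg (fun x : ℝ => (x : ℂ)) (norm_latPt_sq p).symm
  have h0 : (‖latPt p‖ : ℂ) ≠ 0 := by exact_mod_cast (norm_latPt_pos hp).ne'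
  rw [h, ← pow_mul, div_pow]
  field_simp
  ring

/-- Dilation of a lattice point by `m + 1`. -/
def dilate (m : ℕ) (p : ℤ × ℤ) : ℤ × ℤ := (((m : ℤ) + 1) * p.1, ((m : ℤ) + 1) * p.2)

theorem latPt_dilate (m : ℕ) (p : ℤ × ℤ) : latPt (dilate m p) = ((m : ℝ) + 1 : ℝ) * latPt p := by
  simp only [latPt, dilate]; push_cast; ring

theorem normForm_dilate (m : ℕ) (p : ℤ × ℤ) :
    normForm (dilate m p).1 (dilate m p).2 = ((m : ℤ) + 1) ^ 2 * normForm p.1 p.2 := by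
  simp only [normForm, dilate]; ring

theorem epsilon_dilate (m : ℕ) (p : ℤ × ℤ) :
    epsilon (dilate m p).1 (dilate m p).2 = legendreSym 7 ((m : ℤ) + 1) * epsilon p.1 p.2 := by
  rw [epsilon_eq, epsilon_eq, ← legendreSym.mul]
  congr 1
  simp only [dilate]; ring

theorem norm_latPt_dilate (m : ℕ) (p : ℤ × ℤ) :
    ‖latPt (dilate m p)‖ = ((m : ℝ) + 1) * ‖latPt p‖ := by
  rw [latPt_dilate, norm_mul, norm_real, Real.norm_eq_abs, abs_of_pos (by positivity)]

theorem centerTerm_dilate (X j m : ℕ) {p : ℤ × ℤ} (hp : p ≠ 0)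
    (h : ((m : ℤ) + 1) ^ 2 * normForm p.1 p.2 ≤ X) :
    centerTerm j (dilate m p) = rayCoeff p * rayPhase p ^ j *
      (((legendreSym 7 ((m : ℤ) + 1) : ℝ) * rayWeight X (normForm p.1 p.2) (2 * j + 1) m : ℝ) : ℂ) := by
  have h0 : (‖latPt p‖ : ℂ) ≠ 0 := by exact_mod_cast (norm_latPt_pos hp).ne'
  have hm : (((m : ℝ) + 1 : ℝ) : ℂ) ≠ 0 := by
    exact_mod_cast (by positivity : (0 : ℝ) < (m : ℝ) + 1).ne'
  have e1 : rayPhase (dilate m p) = rayPhase p := by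
    rw [rayPhase, rayPhase, norm_latPt_dilate, latPt_dilate, ofReal_mul, mul_div_mul_left _ _ hm]
  have e2 : rayCoeff (dilate m p) =
      rayCoeff p * ((legendreSym 7 ((m : ℤ) + 1) : ℂ) * (1 / (((m : ℝ) + 1 : ℝ) : ℂ))) := by
    rw [rayCoeff, rayCoeff, norm_latPt_dilate, latPt_dilate, epsilon_dilate, ofReal_mul]
    push_cast
    push_cast at hm
    field_simp
  rw [centerTerm, e1, e2, rayWeight, if_pos h, normForm_dilate]
  push_cast
  ring

/-- The primitive lattice points prime to `√-7` and of norm at most `X`. -/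
def primRays (X : ℕ) : Finset (ℤ × ℤ) :=
  (latticeBall X).filter fun p => Int.gcd p.1 p.2 = 1 ∧ ¬ (7 : ℤ) ∣ 2 * p.1 + p.2

theorem mem_primRays {X : ℕ} {p : ℤ × ℤ} :
    p ∈ primRays X ↔ p ∈ latticeBall X ∧ IsCoprime p.1 p.2 ∧ ¬ (7 : ℤ) ∣ 2 * p.1 + p.2 := by
  rw [primRays, Finset.mem_filter, Int.isCoprime_iff_gcd_eq_one]

theorem rayCoeff_eq_zero {p : ℤ × ℤ} (h : (7 : ℤ) ∣ 2 * p.1 + p.2) : rayCoeff p = 0 := by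
  have : epsilon p.1 p.2 = 0 := by
    rw [epsilon_eq, legendreSym.eq_zero_iff]
    exact (ZMod.intCast_zmod_eq_zero_iff_dvd _ 7).mpr (by exact_mod_cast h)
  rw [rayCoeff, this]; simp

/-- A nonzero point is uniquely its gcd times a primitive point. The index is the gcd minus one,
since `dilate m` multiplies by `m + 1`. -/
theorem sum_latticeBall_eq (X : ℕ) (f : ℤ × ℤ → ℂ) :
    ∑ p ∈ latticeBall X, f p = ∑ q ∈ ((((latticeBall X).filter fun p => Int.gcd p.1 p.2 = 1) ×ˢ
      Finset.range X).filter fun q => ((q.2 : ℤ) + 1) ^ 2 * normForm q.1.1 q.1.2 ≤ X),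
      f (dilate q.2 q.1) := by
  symm
  refine Finset.sum_nbij' (fun q => dilate q.2 q.1)
    (fun p => ((p.1 / Int.gcd p.1 p.2, p.2 / Int.gcd p.1 p.2), Int.gcd p.1 p.2 - 1))
    (fun q hq => ?_) (fun p hp => ?_) (fun q hq => ?_) (fun p hp => ?_) (fun q _ => rfl)
  · simp only [Finset.mem_filter, Finset.mem_product] at hq
    rw [mem_latticeBall, normForm_dilate]
    refine ⟨?_, hq.2⟩
    have := (mem_latticeBall.mp hq.1.1.1).1
    have hm : ((q.2 : ℤ) + 1) ≠ 0 := by positivity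
    intro h
    apply this
    have h1 := congrArg Prod.fst h
    have h2 := congrArg Prod.snd h
    simp only [dilate, Prod.fst_zero, Prod.snd_zero, mul_eq_zero, hm, false_or] at h1 h2
    exact Prod.ext h1 h2
  · have hp' := mem_latticeBall.mp hp
    have hg : 0 < Int.gcd p.1 p.2 := by
      rw [Int.gcd_pos_iff]
      by_contra! hcon
      exact hp'.1 (Prod.ext hcon.1 hcon.2)
    set g := Int.gcd p.1 p.2 with hgdef
    have hg1 : ((g - 1 : ℕ) : ℤ) + 1 = g := by omega
    have ea : (g : ℤ) * (p.1 / g) = p.1 := Int.mul_ediv_cancel' (Int.gcd_dvd_left _ _)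
    have eb : (g : ℤ) * (p.2 / g) = p.2 := Int.mul_ediv_cancel' (Int.gcd_dvd_right _ _)
    have hne : (p.1 / (g : ℤ), p.2 / (g : ℤ)) ≠ (0 : ℤ × ℤ) := by
      intro h
      have h1 := congrArg Prod.fst h
      have h2 := congrArg Prod.snd h
      simp only [Prod.fst_zero, Prod.snd_zero] at h1 h2
      rw [h1] at ea; rw [h2] at eb
      exact hp'.1 (Prod.ext (by simpa using ea.symm) (by simpa using eb.symm))
    have hν := one_le_normForm hne
    have hN : (g : ℤ) ^ 2 * normForm (p.1 / g) (p.2 / g) ≤ X := by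
      refine le_trans (le_of_eq ?_) hp'.2
      conv_rhs => rw [← ea, ← eb]
      simp only [normForm]; ring
    simp only at hν
    have hg' : (1 : ℤ) ≤ g := by exact_mod_cast hg
    simp only [Finset.mem_filter, Finset.mem_product, mem_latticeBall, Finset.mem_range]
    refine ⟨⟨⟨⟨hne, ?_⟩, ?_⟩, ?_⟩, ?_⟩
    · exact (le_mul_of_one_le_left (by omega) (one_le_pow₀ hg')).trans hN
    · exact Int.gcd_div_gcd_div_gcd hg
    · have : (g : ℤ) ≤ X := by nlinarith
      omega
    · rw [hg1]; exact hN
  · simp only [Finset.mem_filter, Finset.mem_product] at hq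
    have hm : ((q.2 : ℤ) + 1) ≠ 0 := by positivity
    have hg : Int.gcd (dilate q.2 q.1).1 (dilate q.2 q.1).2 = q.2 + 1 := by
      simp only [dilate]
      rw [Int.gcd_mul_left, hq.1.1.2, mul_one]
      omega
    rw [hg]
    refine Prod.ext (Prod.ext ?_ ?_) ?_
    · simp only [dilate]; push_cast; exact Int.mul_ediv_cancel_left _ hm
    · simp only [dilate]; push_cast; exact Int.mul_ediv_cancel_left _ hm
    · simp
  · have hp' := mem_latticeBall.mp hp
    have hg : 0 < Int.gcd p.1 p.2 := by
      rw [Int.gcd_pos_iff]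
      by_contra! hcon
      exact hp'.1 (Prod.ext hcon.1 hcon.2)
    have hg1 : ((Int.gcd p.1 p.2 - 1 : ℕ) : ℤ) + 1 = Int.gcd p.1 p.2 := by omega
    simp only [dilate]
    rw [hg1]
    exact Prod.ext (Int.mul_ediv_cancel' (Int.gcd_dvd_left _ _))
      (Int.mul_ediv_cancel' (Int.gcd_dvd_right _ _))

theorem sum_centerTerm_eq (X j : ℕ) :
    ∑ p ∈ latticeBall X, centerTerm j p = ∑ p ∈ primRays X,
      rayCoeff p * rayPhase p ^ j * (rayAmp X (normForm p.1 p.2) (2 * j + 1) : ℂ) := by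
  have h1 : ∑ p ∈ primRays X,
      rayCoeff p * rayPhase p ^ j * (rayAmp X (normForm p.1 p.2) (2 * j + 1) : ℂ)
      = ∑ p ∈ (latticeBall X).filter (fun p => Int.gcd p.1 p.2 = 1),
      rayCoeff p * rayPhase p ^ j * (rayAmp X (normForm p.1 p.2) (2 * j + 1) : ℂ) := by
    rw [primRays, ← Finset.filter_filter]
    refine Finset.sum_filter_of_ne fun p _ hne h7 => hne ?_
    rw [rayCoeff_eq_zero h7]; simp
  rw [h1, sum_latticeBall_eq, Finset.sum_filter, Finset.sum_product]
  refine Finset.sum_congr rfl fun p hp => ?_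
  have hp0 := (mem_latticeBall.mp (Finset.mem_filter.mp hp).1).1
  rw [rayAmp, ofReal_sum, Finset.mul_sum]
  refine Finset.sum_congr rfl fun m _ => ?_
  split_ifs with h
  · exact centerTerm_dilate X j m hp0 h
  · simp only at h
    rw [rayWeight, if_neg h]; simp

theorem norm_rayCoeff_le {p : ℤ × ℤ} (hp : p ≠ 0) : ‖rayCoeff p‖ ≤ 1 / ‖latPt p‖ := by
  have h := norm_latPt_pos hp
  rw [rayCoeff, norm_mul, norm_div, norm_pow, norm_real, norm_norm]
  calc _ ≤ 1 * (‖latPt p‖ / ‖latPt p‖ ^ 2) := by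
        gcongr; exact norm_epsilon_le p
    _ = _ := by field_simp

theorem latDet_comm (v w : ℤ × ℤ) : latDet v w = -latDet w v := by
  simp only [latDet]; ring

theorem latTr_comm (v w : ℤ × ℤ) : latTr v w = latTr w v := by
  simp only [latTr]; ring

/-- The trace half is the determinant half for `latRot v`, which is again primitive and no shorter
than `v`. -/
theorem sum_inv_latTr_add_latDet_le {X : ℕ} {v : ℤ × ℤ} (hv : v ∈ primRays X) :
    ∑ w ∈ (primRays X).filter (fun w => latDet v w ≠ 0),
      (1 / |(latTr v w : ℝ)| + 1 / |(latDet v w : ℝ)|)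
      ≤ 14 * Real.sqrt X / ‖latPt v‖ * harm (15 * X) := by
  obtain ⟨hb, hc, h7⟩ := mem_primRays.mp hv
  obtain ⟨hv0, hvX⟩ := mem_latticeBall.mp hb
  have hpos := norm_latPt_pos hv0
  have hnn := normForm_nonneg v.1 v.2
  have h1 := sum_inv_latDet_le (X := X) hv0 hc (by omega)
  have hrot : ‖latPt v‖ ≤ ‖latPt (latRot v)‖ := norm_latRot v
  have hr0 : latRot v ≠ 0 := by
    intro h
    rw [h] at hrot
    simp [latPt] at hrot
    simp [latPt, hrot] at hpos
  have h2 := sum_inv_latDet_le (X := X) hr0 (isCoprime_latRot hc h7)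
    (by rw [normForm_latRot]; omega)
  have h3 : 7 * Real.sqrt X / ‖latPt (latRot v)‖ * harm (15 * X)
      ≤ 7 * Real.sqrt X / ‖latPt v‖ * harm (15 * X) := by
    have := harm_nonneg (15 * X)
    gcongr
  rw [Finset.sum_add_distrib]
  have h4 : ∑ w ∈ (primRays X).filter (fun w => latDet v w ≠ 0), 1 / |(latTr v w : ℝ)| ≤
      ∑ w ∈ (latticeBall X).filter (fun w => latDet (latRot v) w ≠ 0),
        1 / |(latDet (latRot v) w : ℝ)| := by
    simp only [latDet_latRot]
    refine Finset.sum_le_sum_of_subset_of_nonneg (fun w hw => ?_) fun _ _ _ => by positivity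
    rw [Finset.mem_filter, mem_primRays] at hw
    exact Finset.mem_filter.mpr ⟨hw.1.1, latTr_ne_zero h7 hw.1.2.2⟩
  have h5 : ∑ w ∈ (primRays X).filter (fun w => latDet v w ≠ 0), 1 / |(latDet v w : ℝ)| ≤
      ∑ w ∈ (latticeBall X).filter (fun w => latDet v w ≠ 0), 1 / |(latDet v w : ℝ)| := by
    refine Finset.sum_le_sum_of_subset_of_nonneg (fun w hw => ?_) fun _ _ _ => by positivity
    rw [Finset.mem_filter, mem_primRays] at hw
    exact Finset.mem_filter.mpr ⟨hw.1.1, hw.2⟩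
  calc _ ≤ 7 * Real.sqrt X / ‖latPt v‖ * harm (15 * X) +
        7 * Real.sqrt X / ‖latPt v‖ * harm (15 * X) := by linarith
    _ = _ := by ring

theorem eq_or_eq_neg_of_latDet_eq_zero {v w : ℤ × ℤ} (hv : IsCoprime v.1 v.2)
    (hw : IsCoprime w.1 w.2) (h : latDet v w = 0) : w = v ∨ w = -v := by
  obtain ⟨x, y, hxy⟩ := hv
  simp only [latDet] at h
  set t := x * w.1 + y * w.2 with ht
  have h1 : w.1 = t * v.1 := by linear_combination (-w.1) * hxy - y * h
  have h2 : w.2 = t * v.2 := by linear_combination (-w.2) * hxy + x * h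
  rw [h1, h2] at hw
  obtain ⟨a, b, hab⟩ := hw
  have hu : t * (a * v.1 + b * v.2) = 1 := by linear_combination hab
  rcases Int.isUnit_iff.mp (IsUnit.of_mul_eq_one _ hu) with ht1 | ht1
  · left; rw [ht1] at h1 h2; exact Prod.ext (by simpa using h1) (by simpa using h2)
  · right; rw [ht1] at h1 h2; exact Prod.ext (by simpa using h1) (by simpa using h2)

/-- The truncated central values. -/
def centerSum (N i : ℕ) : ℂ := ∑ p ∈ latticeBall (20 * N), centerTerm (N + i) p

/-- The amplitude of a ray in `centerSum N i`. -/
def amp (N : ℕ) (p : ℤ × ℤ) (i : ℕ) : ℝ := rayAmp (20 * N) (normForm p.1 p.2) (2 * (N + i) + 1)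

theorem centerSum_eq (N i : ℕ) : centerSum N i = ∑ p ∈ primRays (20 * N),
    rayCoeff p * rayPhase p ^ N * ((amp N p i : ℂ) * rayPhase p ^ i) := by
  rw [centerSum, sum_centerTerm_eq]
  refine Finset.sum_congr rfl fun p _ => ?_
  rw [amp, pow_add]; ring

theorem abs_amp_le (N : ℕ) {p : ℤ × ℤ} (hp : p ≠ 0) (i : ℕ) : |amp N p i| ≤ 2 :=
  abs_rayAmp_le _ (one_le_normForm hp) _

theorem sum_abs_amp_sub_le (N : ℕ) {p : ℤ × ℤ} (hp : p ≠ 0) (n : ℕ) :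
    ∑ i ∈ Finset.range n, |amp N p (i + 1) - amp N p i| ≤ 9 :=
  sum_abs_rayAmp_sub_le (one_le_normForm hp) le_rfl n

theorem sqrt_twenty_mul_le (N : ℕ) : Real.sqrt ((20 * N : ℕ) : ℝ) ≤ 5 * Real.sqrt N := by
  rw [Real.sqrt_le_left (by positivity), mul_pow, Real.sq_sqrt (by positivity)]
  push_cast
  have : (0 : ℝ) ≤ N := by positivity
  linarith

/-- The rays of `±1` have phase 1 and do not oscillate, so they contribute a positive main term. On
every other ray partial summation saves. The constant is `770 = 11 · 14 · 5`, with `11 = 2 + 9` from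
amplitude plus variation and 5 from `√20 ≤ 5`. -/
theorem first_moment_ge {N : ℕ} (hN : 2 ≤ N) :
    (N : ℝ) / 4 - 770 * Real.sqrt N * harm (300 * N) ≤
      ‖∑ i ∈ Finset.range N, centerSum N i‖ := by
  set q0 : ℤ × ℤ := (1, 0) with hq0
  have hq0ne : q0 ≠ 0 := by simp [hq0]
  have hq0mem : q0 ∈ primRays (20 * N) := by
    rw [mem_primRays, mem_latticeBall]
    refine ⟨⟨hq0ne, ?_⟩, ?_, ?_⟩
    · simp [hq0, normForm]; omega
    · simpa [hq0] using isCoprime_one_left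
    · simp only [hq0]; norm_num
  have hlat0 : latPt q0 = 1 := by simp [hq0, latPt]
  have hphase0 : rayPhase q0 = 1 := by simp [rayPhase, hlat0]
  set S : ℤ × ℤ → ℂ := fun p => rayCoeff p * rayPhase p ^ N *
    ∑ i ∈ Finset.range N, (amp N p i : ℂ) * rayPhase p ^ i with hS
  have hsum : ∑ i ∈ Finset.range N, centerSum N i = ∑ p ∈ primRays (20 * N), S p := by
    simp_rw [centerSum_eq]
    rw [Finset.sum_comm]
    refine Finset.sum_congr rfl fun p _ => ?_
    simp only [hS]
    rw [Finset.mul_sum]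
  rw [hsum, ← Finset.sum_filter_add_sum_filter_not (primRays (20 * N)) (fun p => latDet q0 p ≠ 0)]
  have hoff : ‖∑ p ∈ (primRays (20 * N)).filter (fun p => latDet q0 p ≠ 0), S p‖
      ≤ 770 * Real.sqrt N * harm (300 * N) := by
    have h1 : ∀ p ∈ (primRays (20 * N)).filter (fun p => latDet q0 p ≠ 0),
        ‖S p‖ ≤ 11 * (1 / |(latTr q0 p : ℝ)| + 1 / |(latDet q0 p : ℝ)|) := by
      intro p hp
      rw [Finset.mem_filter, mem_primRays] at hp
      have hp0 := (mem_latticeBall.mp hp.1.1).1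
      have hT : latTr p q0 ≠ 0 := latTr_ne_zero hp.1.2.2 (by simp only [hq0]; norm_num)
      have hD : latDet p q0 ≠ 0 := by rw [latDet_comm]; simpa using hp.2
      obtain ⟨hs1, hs2⟩ := rayPhase_sep hp0 hq0ne hD hT
      rw [hphase0, map_one, mul_one] at hs1 hs2
      rw [hlat0, norm_one, mul_one, latTr_comm, latDet_comm, Int.cast_neg, abs_neg] at hs2
      have hk := norm_sum_mul_pow_le (norm_rayPhase hp0) hs1 (abs_amp_le N hp0)
        (sum_abs_amp_sub_le N hp0) N
      have hpos := norm_latPt_pos hp0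
      simp only [hS]
      rw [norm_mul, norm_mul, norm_pow, norm_rayPhase hp0, one_pow, mul_one]
      calc _ ≤ 1 / ‖latPt p‖ * ((‖latPt p‖ *
            (1 / |(latTr q0 p : ℝ)| + 1 / |(latDet q0 p : ℝ)|)) * (2 + 9)) := by
            gcongr
            · exact norm_rayCoeff_le hp0
            · exact hk.trans (by gcongr)
        _ = _ := by field_simp; ring
    refine (norm_sum_le _ _).trans ((Finset.sum_le_sum h1).trans ?_)
    rw [← Finset.mul_sum]
    have h2 := sum_inv_latTr_add_latDet_le hq0mem
    rw [hlat0, norm_one, div_one, show 15 * (20 * N) = 300 * N by ring] at h2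
    have h3 := sqrt_twenty_mul_le N
    have h4 := harm_nonneg (300 * N)
    calc _ ≤ 11 * (14 * (5 * Real.sqrt N) * harm (300 * N)) := by
          refine mul_le_mul_of_nonneg_left (h2.trans ?_) (by norm_num)
          gcongr
      _ = _ := by ring
  have hdiag : (N : ℝ) / 4 ≤
      (∑ p ∈ (primRays (20 * N)).filter (fun p => ¬ latDet q0 p ≠ 0), S p).re := by
    have hval : ∀ p ∈ (primRays (20 * N)).filter (fun p => ¬ latDet q0 p ≠ 0),
        S p = ((∑ i ∈ Finset.range N, rayAmp (20 * N) 1 (2 * (N + i) + 1) : ℝ) : ℂ) := by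
      intro p hp
      rw [Finset.mem_filter, mem_primRays, not_not] at hp
      have hcop : IsCoprime q0.1 q0.2 := by simpa [hq0] using isCoprime_one_left
      -- At `-1` the sign and the lattice point both change sign, so the generators `1` and `-1`
      -- contribute equally.
      have v2 : legendreSym 7 2 = 1 ∧ legendreSym 7 (-2) = -1 := by decide
      rcases eq_or_eq_neg_of_latDet_eq_zero hcop hp.1.2.1 hp.2 with h | h
      · rw [h]
        simp only [hS, rayCoeff, hphase0, hlat0, amp]
        simp [hq0, epsilon_eq, v2.1, normForm]
      · have hl : latPt p = -1 := by rw [h]; simp [hq0, latPt]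
        have hph : rayPhase p = 1 := by
          rw [rayPhase, hl]; norm_num
        simp only [hS, rayCoeff, hph, hl, amp]
        rw [h]
        simp [hq0, epsilon_eq, v2.2, normForm]
    have hge : (N : ℝ) / 4 ≤ ∑ i ∈ Finset.range N, rayAmp (20 * N) 1 (2 * (N + i) + 1) := by
      calc (N : ℝ) / 4 = ∑ i ∈ Finset.range N, (1 / 4 : ℝ) := by simp; ring
        _ ≤ _ := Finset.sum_le_sum fun i _ => rayAmp_one_ge (by omega) (by omega)
    rw [Finset.sum_congr rfl hval, Finset.sum_const, nsmul_eq_mul, ← ofReal_natCast, ← ofReal_mul,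
      ofReal_re]
    have hcard : 1 ≤ ((primRays (20 * N)).filter (fun p => ¬ latDet q0 p ≠ 0)).card :=
      Finset.card_pos.mpr ⟨q0, Finset.mem_filter.mpr ⟨hq0mem, by simp [latDet, hq0]⟩⟩
    have hcard' : (1 : ℝ) ≤ ((primRays (20 * N)).filter (fun p => ¬ latDet q0 p ≠ 0)).card := by
      exact_mod_cast hcard
    have hN0 : (0 : ℝ) ≤ (N : ℝ) / 4 := by positivity
    nlinarith
  have h1 := re_le_norm (∑ p ∈ (primRays (20 * N)).filter (fun p => ¬ latDet q0 p ≠ 0), S p)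
  have h2 := norm_sub_le
    (∑ p ∈ (primRays (20 * N)).filter (fun p => latDet q0 p ≠ 0), S p +
      ∑ p ∈ (primRays (20 * N)).filter (fun p => ¬ latDet q0 p ≠ 0), S p)
    (∑ p ∈ (primRays (20 * N)).filter (fun p => latDet q0 p ≠ 0), S p)
  rw [add_sub_cancel_left] at h2
  linarith

end

/-! ### The second moment, truncation error and Cauchy–Schwarz. -/

section

open Complex

/-- The square is opened over pairs of rays. Off the diagonal, separation of phases bounds the sum
over `q` by `√N log N/|p|`, and summing `1/|p|` costs another `√N log N`. The diagonal `q = ±p`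
contributes `N ∑ 1/|p|²`, which is also `O(N log² N)`. -/
theorem second_moment_le (N : ℕ) :
    ∑ i ∈ Finset.range N, ‖centerSum N i‖ ^ 2 ≤ 10 ^ 5 * N * harm (300 * N) ^ 2 := by
  set P := primRays (20 * N) with hP
  set H := harm (300 * N) with hH
  have hH0 : 0 ≤ H := harm_nonneg _
  set B : ℤ × ℤ → ℂ := fun p => rayCoeff p * rayPhase p ^ N with hB
  set K : ℤ × ℤ → ℤ × ℤ → ℂ := fun p q => ∑ i ∈ Finset.range N,
    ((amp N p i * amp N q i : ℝ) : ℂ) * (rayPhase p * (starRingEnd ℂ) (rayPhase q)) ^ i with hK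
  have hmem0 : ∀ p ∈ P, p ≠ 0 := fun p hp => (mem_latticeBall.mp (mem_primRays.mp hp).1).1
  have hexp : ((∑ i ∈ Finset.range N, ‖centerSum N i‖ ^ 2 : ℝ) : ℂ)
      = ∑ p ∈ P, ∑ q ∈ P, B p * (starRingEnd ℂ) (B q) * K p q := by
    push_cast
    have h1 : ∀ i, (‖centerSum N i‖ : ℂ) ^ 2 = ∑ p ∈ P, ∑ q ∈ P,
        B p * (starRingEnd ℂ) (B q) * (((amp N p i * amp N q i : ℝ) : ℂ) *
          (rayPhase p * (starRingEnd ℂ) (rayPhase q)) ^ i) := by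
      intro i
      rw [← ofReal_pow, ← normSq_eq_norm_sq, ← mul_conj, centerSum_eq, map_sum,
        Finset.sum_mul_sum]
      refine Finset.sum_congr rfl fun p _ => Finset.sum_congr rfl fun q _ => ?_
      simp only [hB, map_mul, map_pow, conj_ofReal]
      push_cast
      rw [mul_pow]
      ring
    simp_rw [h1]
    rw [Finset.sum_comm]
    refine Finset.sum_congr rfl fun p _ => ?_
    rw [Finset.sum_comm]
    refine Finset.sum_congr rfl fun q _ => ?_
    simp only [hK]
    rw [Finset.mul_sum]
  have hBn : ∀ p ∈ P, ‖B p‖ ≤ 1 / ‖latPt p‖ := by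
    intro p hp
    simp only [hB]
    rw [norm_mul, norm_pow, norm_rayPhase (hmem0 p hp), one_pow, mul_one]
    exact norm_rayCoeff_le (hmem0 p hp)
  have hterm : ∀ p ∈ P, ∀ q ∈ P, ‖B p * (starRingEnd ℂ) (B q) * K p q‖ ≤
      1 / ‖latPt p‖ * (1 / ‖latPt q‖) * ‖K p q‖ := by
    intro p hp q hq
    rw [norm_mul, norm_mul, norm_conj]
    gcongr
    · exact hBn p hp
    · exact hBn q hq
  have hampm : ∀ p ∈ P, ∀ q ∈ P, ∀ i, |amp N p i * amp N q i| ≤ 4 := by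
    intro p hp q hq i
    rw [abs_mul]
    have := mul_le_mul (abs_amp_le N (hmem0 p hp) i) (abs_amp_le N (hmem0 q hq) i)
      (abs_nonneg _) (by norm_num)
    linarith
  have hoff : ∀ p ∈ P, ∑ q ∈ P.filter (fun q => latDet p q ≠ 0),
      ‖B p * (starRingEnd ℂ) (B q) * K p q‖ ≤ 2800 * Real.sqrt N * H * (1 / ‖latPt p‖) := by
    intro p hp
    have hp0 := hmem0 p hp
    have hpp := norm_latPt_pos hp0
    have h1 : ∀ q ∈ P.filter (fun q => latDet p q ≠ 0), ‖B p * (starRingEnd ℂ) (B q) * K p q‖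
        ≤ 40 * (1 / |(latTr p q : ℝ)| + 1 / |(latDet p q : ℝ)|) := by
      intro q hq
      obtain ⟨hq1, hq2⟩ := Finset.mem_filter.mp hq
      have hq0 := hmem0 q hq1
      have hqp := norm_latPt_pos hq0
      obtain ⟨hs1, hs2⟩ := rayPhase_sep hp0 hq0 hq2
        (latTr_ne_zero (mem_primRays.mp hp).2.2 (mem_primRays.mp hq1).2.2)
      have hz : ‖rayPhase p * (starRingEnd ℂ) (rayPhase q)‖ = 1 := by
        rw [norm_mul, norm_conj, norm_rayPhase hp0, norm_rayPhase hq0, one_mul]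
      -- A product of two amplitudes is bounded by 4 and has variation at most `2 · 2 · 9`, whence
      -- the factor 40 below.
      have hk := norm_sum_mul_pow_le (c := fun i => amp N p i * amp N q i) hz hs1 (hampm p hp q hq1)
        (variation_mul_le (abs_amp_le N hp0) (sum_abs_amp_sub_le N hp0)
          (abs_amp_le N hq0) (sum_abs_amp_sub_le N hq0)) N
      refine (hterm p hp q hq1).trans ?_
      calc _ ≤ 1 / ‖latPt p‖ * (1 / ‖latPt q‖) * ((‖latPt p‖ * ‖latPt q‖ *
            (1 / |(latTr p q : ℝ)| + 1 / |(latDet p q : ℝ)|)) * (4 + 2 * 2 * 9)) := by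
            gcongr
            exact hk.trans (by gcongr)
        _ = _ := by field_simp; ring
    refine (Finset.sum_le_sum h1).trans ?_
    rw [← Finset.mul_sum]
    have h2 := sum_inv_latTr_add_latDet_le hp
    rw [show 15 * (20 * N) = 300 * N by ring, ← hH] at h2
    have h3 := sqrt_twenty_mul_le N
    calc _ ≤ 40 * (14 * (5 * Real.sqrt N) / ‖latPt p‖ * H) := by
          refine mul_le_mul_of_nonneg_left (h2.trans ?_) (by norm_num)
          gcongr
      _ = _ := by ring
  have hdiag : ∀ p ∈ P, ∑ q ∈ P.filter (fun q => ¬ latDet p q ≠ 0),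
      ‖B p * (starRingEnd ℂ) (B q) * K p q‖ ≤ 8 * N * (1 / ‖latPt p‖ ^ 2) := by
    intro p hp
    have hp0 := hmem0 p hp
    have hsub : P.filter (fun q => ¬ latDet p q ≠ 0) ⊆ {p, -p} := by
      intro q hq
      rw [Finset.mem_filter, not_not] at hq
      have := eq_or_eq_neg_of_latDet_eq_zero (mem_primRays.mp hp).2.1
        (mem_primRays.mp hq.1).2.1 hq.2
      simpa using this
    have h1 : ∀ q ∈ P.filter (fun q => ¬ latDet p q ≠ 0), ‖B p * (starRingEnd ℂ) (B q) * K p q‖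
        ≤ 4 * N * (1 / ‖latPt p‖ ^ 2) := by
      intro q hq
      have hqP := (Finset.mem_filter.mp hq).1
      have hn : ‖latPt q‖ = ‖latPt p‖ := by
        have := hsub hq
        rw [Finset.mem_insert, Finset.mem_singleton] at this
        rcases this with h | h
        · rw [h]
        · rw [h, ← norm_neg]; congr 1; simp [latPt]; ring
      have hKn : ‖K p q‖ ≤ 4 * N := by
        simp only [hK]
        refine (norm_sum_le _ _).trans ?_
        have : ∀ i ∈ Finset.range N, ‖((amp N p i * amp N q i : ℝ) : ℂ) *
            (rayPhase p * (starRingEnd ℂ) (rayPhase q)) ^ i‖ ≤ 4 := by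
          intro i _
          rw [norm_mul, norm_pow, norm_mul, norm_conj, norm_rayPhase hp0,
            norm_rayPhase (hmem0 q hqP), norm_real, Real.norm_eq_abs]
          simpa using hampm p hp q hqP i
        refine (Finset.sum_le_card_nsmul _ _ _ this).trans ?_
        rw [Finset.card_range, nsmul_eq_mul, mul_comm]
      refine (hterm p hp q hqP).trans ?_
      rw [hn]
      calc _ ≤ 1 / ‖latPt p‖ * (1 / ‖latPt p‖) * (4 * N) := by gcongr
        _ = _ := by ring
    refine (Finset.sum_le_card_nsmul _ _ _ h1).trans ?_
    have hc : ((P.filter (fun q => ¬ latDet p q ≠ 0)).card : ℝ) ≤ 2 := by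
      exact_mod_cast (Finset.card_le_card hsub).trans Finset.card_le_two
    rw [nsmul_eq_mul]
    calc _ ≤ 2 * (4 * N * (1 / ‖latPt p‖ ^ 2)) := by gcongr
      _ = _ := by ring
  have htotal : ∑ i ∈ Finset.range N, ‖centerSum N i‖ ^ 2 ≤
      ∑ p ∈ P, (2800 * Real.sqrt N * H * (1 / ‖latPt p‖) + 8 * N * (1 / ‖latPt p‖ ^ 2)) := by
    have h0 : 0 ≤ ∑ i ∈ Finset.range N, ‖centerSum N i‖ ^ 2 := by positivity
    rw [← abs_of_nonneg h0, ← Real.norm_eq_abs, ← norm_real, hexp]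
    refine (norm_sum_le _ _).trans (Finset.sum_le_sum fun p hp => ?_)
    refine (norm_sum_le _ _).trans ?_
    rw [← Finset.sum_filter_add_sum_filter_not P (fun q => latDet p q ≠ 0)]
    exact add_le_add (hoff p hp) (hdiag p hp)
  refine htotal.trans ?_
  rw [Finset.sum_add_distrib, ← Finset.mul_sum, ← Finset.mul_sum]
  have hsubP : P ⊆ latticeBall (20 * N) := Finset.filter_subset _ _
  set b := Nat.sqrt (2 * (20 * N)) with hb
  have hb2 : (b : ℝ) ≤ 7 * Real.sqrt N := by
    refine le_of_sq_le_sq ?_ (by positivity)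
    rw [mul_pow, Real.sq_sqrt (by positivity)]
    have : b ^ 2 ≤ 2 * (20 * N) := Nat.sqrt_le' _
    have : (b : ℝ) ^ 2 ≤ 2 * (20 * N) := by exact_mod_cast this
    have : (0 : ℝ) ≤ N := by positivity
    linarith
  rcases Nat.eq_zero_or_pos N with hN | hN
  · subst hN
    simp
  have hs1 : 1 ≤ Real.sqrt N := by
    rw [Real.one_le_sqrt]; exact_mod_cast hN
  have hbH : harm b ≤ H := by
    refine harm_mono ?_
    refine (Nat.sqrt_le_self _).trans (by omega)
  have hb0 := harm_nonneg b
  have e1 : ∑ p ∈ P, 1 / ‖latPt p‖ ≤ 30 * Real.sqrt N * H := by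
    refine (Finset.sum_le_sum_of_subset_of_nonneg hsubP fun _ _ _ => by positivity).trans
      ((sum_inv_norm_le _).trans ?_)
    rw [← hb]
    calc _ ≤ 2 * (2 * (7 * Real.sqrt N) + Real.sqrt N) * H := by gcongr
      _ = _ := by ring
  have e2 : ∑ p ∈ P, 1 / ‖latPt p‖ ^ 2 ≤ 4 * H ^ 2 := by
    refine (Finset.sum_le_sum_of_subset_of_nonneg hsubP fun _ _ _ => by positivity).trans
      ((sum_inv_norm_sq_le _).trans ?_)
    rw [← hb]
    gcongr
  calc _ ≤ 2800 * Real.sqrt N * H * (30 * Real.sqrt N * H) + 8 * N * (4 * H ^ 2) := by gcongr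
    _ = 84000 * (Real.sqrt N ^ 2) * H ^ 2 + 32 * N * H ^ 2 := by ring
    _ = 84032 * (N * H ^ 2) := by rw [Real.sq_sqrt (by positivity)]; ring
    _ ≤ 10 ^ 5 * (N * H ^ 2) := by gcongr; norm_num
    _ = _ := by ring

theorem norm_centerTerm_le (j : ℕ) {p : ℤ × ℤ} (hp : p ≠ 0) :
    ‖centerTerm j p‖ ≤ poissonTail (2 * j + 1) (2 * Real.pi / 7 * (normForm p.1 p.2 : ℝ)) := by
  have h0 := poissonTail_nonneg (2 * j + 1) (mul_normForm_pos hp).le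
  have h1 : ‖rayCoeff p‖ ≤ 1 := by
    refine (norm_rayCoeff_le hp).trans ?_
    rw [div_le_one (norm_latPt_pos hp)]
    have h := norm_latPt_sq p
    have h1 : (1 : ℝ) ≤ (normForm p.1 p.2 : ℝ) := by exact_mod_cast one_le_normForm hp
    nlinarith [norm_nonneg (latPt p)]
  rw [centerTerm, norm_mul, norm_mul, norm_pow, norm_rayPhase hp, one_pow, mul_one, norm_real,
    Real.norm_eq_abs, abs_of_nonneg h0]
  exact mul_le_of_le_one_left h0 h1

/-- Beyond norm `20N` the mean `2πN(α)/7` far exceeds the Poisson cutoff, which is below `4N`. The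
decay `exp(-πN(α)/7)` beats `2^(4N) ≤ exp(4N)`, with room for both `exp(-N)` and a summable factor
`exp(-πN(α)/28)`, since `20 · 3π/28 > 5`. -/
theorem exists_norm_heckeL_sub_centerSum_le : ∃ C : ℝ, 0 ≤ C ∧ ∀ N i : ℕ, i < N →
    ‖heckeL (4 * (N + i) + 1) (1 / 2) - centerSum N i‖ ≤ C * Real.exp (-(N : ℝ)) := by
  have hs := summable_exp_neg_normForm (c := 2 * Real.pi / 7 / 8) (by positivity)
  refine ⟨∑' p : ℤ × ℤ, Real.exp (-(2 * Real.pi / 7 / 8) * (normForm p.1 p.2 : ℝ)),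
    tsum_nonneg fun _ => (Real.exp_pos _).le, fun N i hi => ?_⟩
  have h1 := hasSum_centerTerm (N + i)
  have h2 : HasSum (fun p => if p ∈ latticeBall (20 * N) then centerTerm (N + i) p else 0)
      (centerSum N i) := by
    rw [centerSum, ← Finset.sum_congr rfl (fun p hp => if_pos hp)]
    exact hasSum_sum_of_ne_finset_zero fun p hp => if_neg hp
  rw [← (h1.sub h2).tsum_eq]
  refine tsum_of_norm_bounded (hs.hasSum.mul_right _) fun p => ?_
  by_cases hp : p ∈ latticeBall (20 * N)
  · rw [if_pos hp, sub_self, norm_zero]; positivity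
  rw [if_neg hp, sub_zero]
  rcases eq_or_ne p 0 with rfl | hp0
  · simp [centerTerm, rayCoeff, epsilon_zero]; positivity
  have hN : 20 * (N : ℝ) ≤ (normForm p.1 p.2 : ℝ) := by
    rw [mem_latticeBall] at hp
    push Not at hp
    have := hp hp0
    push_cast at this
    exact_mod_cast this.le
  refine (norm_centerTerm_le _ hp0).trans ((poissonTail_le _ (mul_normForm_pos hp0).le).trans ?_)
  have h3 : (2 : ℝ) ^ (2 * (N + i) + 1) ≤ Real.exp (4 * N) := by
    calc (2 : ℝ) ^ (2 * (N + i) + 1) ≤ 2 ^ (4 * N) := pow_le_pow_right₀ (by norm_num) (by omega)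
      _ ≤ Real.exp 1 ^ (4 * N) := by
          gcongr
          linarith [Real.add_one_le_exp (1 : ℝ)]
      _ = Real.exp (4 * N) := by rw [← Real.exp_nat_mul]; push_cast; ring_nf
  calc _ ≤ Real.exp (4 * N) * Real.exp (-(2 * Real.pi / 7 * (normForm p.1 p.2 : ℝ) / 2)) := by
        gcongr
    _ ≤ _ := by
        rw [← Real.exp_add, ← Real.exp_add]
        refine Real.exp_le_exp.mpr ?_
        have : (0 : ℝ) ≤ N := by positivity
        nlinarith [Real.pi_gt_d2]

theorem harm_le_log {N : ℕ} (hN : 3 ≤ N) : harm (300 * N) ≤ 18 * Real.log N := by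
  have h := harm_le (300 * N)
  have h3 : (3 : ℝ) ≤ N := by exact_mod_cast hN
  have hlog : 1 ≤ Real.log N := by
    rw [Real.le_log_iff_exp_le (by linarith)]
    linarith [Real.exp_one_lt_d9]
  have h300 : Real.log 300 ≤ 6 := by
    rw [Real.log_le_iff_le_exp (by norm_num), show (6 : ℝ) = (6 : ℕ) * 1 by norm_num,
      Real.exp_nat_mul]
    calc (300 : ℝ) ≤ 2.7 ^ 6 := by norm_num
      _ ≤ _ := by gcongr; linarith [Real.exp_one_gt_d9]
  push_cast at h
  rw [Real.log_mul (by norm_num) (by linarith)] at h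
  linarith

theorem eventually_sqrt_mul_log_le :
    ∀ᶠ N : ℕ in atTop, 770 * Real.sqrt N * (18 * Real.log N) ≤ (N : ℝ) / 16 := by
  have h := (isLittleO_log_rpow_atTop (r := 1 / 2) (by norm_num)).def
    (c := 1 / (770 * 18 * 16)) (by norm_num)
  filter_upwards [tendsto_natCast_atTop_atTop.eventually h, eventually_ge_atTop 1] with N hN h1
  have h1' : (1 : ℝ) ≤ N := by exact_mod_cast h1
  rw [Real.norm_eq_abs, Real.norm_eq_abs, abs_of_nonneg (Real.log_nonneg h1'), ← Real.sqrt_eq_rpow,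
    abs_of_nonneg (Real.sqrt_nonneg _)] at hN
  have hs := Real.mul_self_sqrt (show (0 : ℝ) ≤ N by positivity)
  have h0 := Real.sqrt_nonneg (N : ℝ)
  nlinarith [mul_le_mul_of_nonneg_left hN h0]

/-- Cauchy–Schwarz on the set of nonvanishing indices: the squared first moment, at least `(N/8)²`,
is at most the number of such indices times the second moment. -/
theorem exists_card_ne_zero_ge : ∃ c : ℝ, 0 < c ∧ ∀ᶠ N : ℕ in atTop,
    c * ((N : ℝ) / Real.log N ^ 2) ≤
      (((Finset.range N).filter fun i => heckeL (4 * (N + i) + 1) (1 / 2) ≠ 0).card : ℝ) := by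
  obtain ⟨C, hC0, hC⟩ := exists_norm_heckeL_sub_centerSum_le
  refine ⟨1 / (64 * (10 ^ 8 + 2 * C ^ 2)), by positivity, ?_⟩
  have hexp : ∀ᶠ N : ℕ in atTop, C * Real.exp (-(N : ℝ)) ≤ 1 / 16 := by
    have h : Tendsto (fun N : ℕ => C * Real.exp (-(N : ℝ))) atTop (nhds (C * 0)) :=
      (Real.tendsto_exp_neg_atTop_nhds_zero.comp tendsto_natCast_atTop_atTop).const_mul C
    rw [mul_zero] at h
    exact h.eventually_le_const (by norm_num)
  filter_upwards [hexp, eventually_sqrt_mul_log_le, eventually_ge_atTop 3] with N hN1 hN2 hN3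
  set L : ℕ → ℂ := fun i => heckeL (4 * (N + i) + 1) (1 / 2) with hL
  have h3 : (3 : ℝ) ≤ N := by exact_mod_cast hN3
  have hlog : 1 ≤ Real.log N := by
    rw [Real.le_log_iff_exp_le (by linarith)]
    linarith [Real.exp_one_lt_d9]
  have hH := harm_le_log hN3
  have hH0 := harm_nonneg (300 * N)
  have hfirst : (N : ℝ) / 8 ≤ ‖∑ i ∈ Finset.range N, L i‖ := by
    have h1 := first_moment_ge (N := N) (by omega)
    have h2 : ‖∑ i ∈ Finset.range N, centerSum N i - ∑ i ∈ Finset.range N, L i‖ ≤ (N : ℝ) / 16 := by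
      rw [← Finset.sum_sub_distrib]
      refine (norm_sum_le _ _).trans ?_
      refine (Finset.sum_le_card_nsmul _ _ (1 / 16) fun i hi => ?_).trans ?_
      · rw [norm_sub_rev]
        exact (hC N i (Finset.mem_range.mp hi)).trans hN1
      · rw [Finset.card_range, nsmul_eq_mul]; apply le_of_eq; ring
    have h4 := norm_sub_norm_le (∑ i ∈ Finset.range N, centerSum N i) (∑ i ∈ Finset.range N, L i)
    have h5 : 770 * Real.sqrt N * harm (300 * N) ≤ 770 * Real.sqrt N * (18 * Real.log N) := by
      gcongr
    linarith
  have hsecond : ∑ i ∈ Finset.range N, ‖L i‖ ^ 2 ≤ (10 ^ 8 + 2 * C ^ 2) * N * Real.log N ^ 2 := by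
    have h1 : ∀ i ∈ Finset.range N, ‖L i‖ ^ 2 ≤ 2 * ‖centerSum N i‖ ^ 2 + 2 * C ^ 2 := by
      intro i hi
      have h2 : ‖L i - centerSum N i‖ ≤ C := by
        refine (hC N i (Finset.mem_range.mp hi)).trans (mul_le_of_le_one_right hC0 ?_)
        rw [Real.exp_le_one_iff]; linarith
      have h4 : ‖L i‖ ≤ ‖centerSum N i‖ + C := by
        have := norm_sub_norm_le (L i) (centerSum N i)
        linarith
      have h5 := pow_le_pow_left₀ (norm_nonneg _) h4 2
      nlinarith [sq_nonneg (‖centerSum N i‖ - C)]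
    refine (Finset.sum_le_sum h1).trans ?_
    rw [Finset.sum_add_distrib, ← Finset.mul_sum, Finset.sum_const, Finset.card_range, nsmul_eq_mul]
    have h2 := second_moment_le N
    have h4 : harm (300 * N) ^ 2 ≤ (18 * Real.log N) ^ 2 := pow_le_pow_left₀ hH0 hH 2
    have h5 : 1 ≤ Real.log N ^ 2 := one_le_pow₀ hlog
    calc _ ≤ 2 * (10 ^ 5 * N * (18 * Real.log N) ^ 2) + N * (2 * C ^ 2) * Real.log N ^ 2 := by
          refine add_le_add (mul_le_mul_of_nonneg_left (h2.trans (by gcongr)) (by norm_num)) ?_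
          exact le_mul_of_one_le_right (by positivity) h5
      _ = (64800000 + 2 * C ^ 2) * N * Real.log N ^ 2 := by ring
      _ ≤ _ := by gcongr; norm_num
  set Z := (Finset.range N).filter fun i => L i ≠ 0 with hZ
  have hcs : ((N : ℝ) / 8) ^ 2 ≤ Z.card * ((10 ^ 8 + 2 * C ^ 2) * N * Real.log N ^ 2) := by
    have h1 : ∑ i ∈ Finset.range N, L i = ∑ i ∈ Z, L i := (Finset.sum_filter_ne_zero _).symm
    have h2 : ‖∑ i ∈ Z, L i‖ ^ 2 ≤ Z.card * ∑ i ∈ Z, ‖L i‖ ^ 2 :=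
      (pow_le_pow_left₀ (norm_nonneg _) (norm_sum_le _ _) 2).trans sq_sum_le_card_mul_sum_sq
    have h4 : ∑ i ∈ Z, ‖L i‖ ^ 2 ≤ ∑ i ∈ Finset.range N, ‖L i‖ ^ 2 :=
      Finset.sum_le_sum_of_subset_of_nonneg (Finset.filter_subset _ _) fun _ _ _ => by positivity
    rw [h1] at hfirst
    calc ((N : ℝ) / 8) ^ 2 ≤ ‖∑ i ∈ Z, L i‖ ^ 2 := pow_le_pow_left₀ (by positivity) hfirst 2
      _ ≤ _ := h2.trans (mul_le_mul_of_nonneg_left (h4.trans hsecond) (by positivity))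
  have hD : 0 < 10 ^ 8 + 2 * C ^ 2 := by positivity
  have hl2 : 0 < Real.log N ^ 2 := by positivity
  rw [div_mul_div_comm, one_mul, div_le_iff₀ (by positivity)]
  have hNpos : (0 : ℝ) < N := by linarith
  refine le_of_mul_le_mul_left ?_ hNpos
  nlinarith [hcs]

end

end HeckeSeven

end

/-! ### From dyadic blocks to initial segments. -/

theorem mainTheorem3 :
    (∀ n : ℕ, 1 ≤ n → HeckeSeven.IsHeckeLFunction (4 * n - 3) (HeckeSeven.heckeL (4 * n - 3))) ∧
    ∃ c : ℝ, 0 < c ∧ ∀ᶠ N : ℕ in atTop,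
      c * ((N : ℝ) / Real.log (N : ℝ) ^ 2) ≤
        (({n : ℕ | 1 ≤ n ∧ n ≤ N ∧ HeckeSeven.heckeL (4 * n - 3) (1 / 2) ≠ 0}.ncard : ℕ) : ℝ) := by
  refine ⟨fun n hn => HeckeSeven.isHeckeLFunction_heckeL (by omega), ?_⟩
  obtain ⟨c, hc, h⟩ := HeckeSeven.exists_card_ne_zero_ge
  refine ⟨c / 3, by positivity, ?_⟩
  obtain ⟨N0, hN0⟩ := eventually_atTop.mp h
  filter_upwards [eventually_ge_atTop (2 * N0 + 6)] with N hN
  have h1 := hN0 (N / 2) (by omega)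
  -- The block `m ≤ j < 2m` corresponds to `n = j + 1 ≤ 2m ≤ N`, since `4n - 3 = 4j + 1`. Replacing
  -- `m` by `N` costs the factor 3, because `N ≤ 3m`.
  set m := N / 2 with hm
  have hcard : ((Finset.range m).filter fun i =>
      HeckeSeven.heckeL (4 * (m + i) + 1) (1 / 2) ≠ 0).card ≤
      {n : ℕ | 1 ≤ n ∧ n ≤ N ∧ HeckeSeven.heckeL (4 * n - 3) (1 / 2) ≠ 0}.ncard := by
    have hinj : Function.Injective fun i : ℕ => m + i + 1 := fun a b hab => by
      simp only at hab; omega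
    rw [← Finset.card_image_of_injective _ hinj, ← Set.ncard_coe_finset]
    refine Set.ncard_le_ncard (fun n hn => ?_)
      ((Set.finite_Iic N).subset fun n hn => hn.2.1)
    rw [Finset.coe_image] at hn
    obtain ⟨i, hi, rfl⟩ := hn
    rw [Finset.mem_coe, Finset.mem_filter, Finset.mem_range] at hi
    dsimp only
    refine ⟨by omega, by omega, ?_⟩
    rw [show 4 * (m + i + 1) - 3 = 4 * (m + i) + 1 by omega]
    exact hi.2
  refine le_trans ?_ (h1.trans (by exact_mod_cast hcard))
  have hm3 : (N : ℝ) ≤ 3 * m := by exact_mod_cast (by omega : N ≤ 3 * m)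
  have hmN : (m : ℝ) ≤ N := by exact_mod_cast (by omega : m ≤ N)
  have hm2 : (2 : ℝ) ≤ m := by exact_mod_cast (by omega : 2 ≤ m)
  have hlog : 0 < Real.log m := Real.log_pos (by linarith)
  have hle : Real.log m ≤ Real.log N := Real.log_le_log (by linarith) hmN
  calc c / 3 * ((N : ℝ) / Real.log N ^ 2) ≤ c / 3 * ((3 * m) / Real.log m ^ 2) := by gcongr
    _ = _ := by ring
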